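/- \textbf{SetDisjointness.} An instance is a family of nonempty finite sets $S_1,\dots,S_m$ of natural numbers; its total size is $N=\sum_{i=1}^m|S_i|$. After an (unrestricted) preprocessing phase, on a query $(i,j)$ one has to decide whether $S_i\cap S_j=\emptyset$. A \emph{data structure} consists of a preprocessing map, which turns every instance into a sequence of words, and one fixed deterministic query program for the unit-cost word RAM with words of $O(\log N)$ bits (with a read-only memory holding the data structure, finitely many registers, and a working memory that is initially zero). The \emph{space} used on an instance is the number of words of this sequence, and the \emph{query time} on an instance is the maximal number of steps over all queries $(i,j)$. \textbf{Strong SetDisjointness Conjecture.} If a data structure solves SetDisjointness on all instances and uses space at most $S(N)$ and query time at most $T(N)$ on all instances of total size $N$, then $S(N)=\tilde\Omega(N^2/T(N)^2)$, i.e. there are $c>0$ and $k\in\mathbb N$ such that $S(N)\ge c\,\frac{N^2}{T(N)^2\log^k N}$ for all sufficiently large $N$. \textbf{Theorem.} Assume the Strong SetDisjointness Conjecture. Let $\delta>0$ and let $u:\mathbb N\to\mathbb N$ be any function with $u(N)\in[N^\delta,N]$ for all sufficiently large $N$. Then any data structure that solves SetDisjointness on all instances of sets $S_1,\dots,S_m\subseteq[u(N)]$,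 where $N=\sum_{i=1}^m|S_i|$, must either use $\Omega(m^{2-o(1)})$ space or have $\tilde\Omega(u^{1/2-o(1)})$ query time, in the following sense: for all $\varepsilon_1,\varepsilon_2>0$ and every $C$, for all sufficiently large $N$ there is an instance of total size $N$ with sets $S_1,\dots,S_m\subseteq[u(N)]$ on which the data structure uses more than $C\,m^{2-\varepsilon_1}$ words of space or some query takes more than $C\,u(N)^{1/2-\varepsilon_2}$ steps. -/

import Mathlib

open Filter

/-! ### Instances of SetDisjointness -/

/-- An instance of SetDisjointness: nonempty finite sets `S_1, …, S_m` of natural numbers.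
The data structure only ever sees indices of sets in queries, so the names of the elements
carry no meaning and `ℕ` serves as the unrestricted universe. -/
structure SetFamily where
  m : ℕ
  set : Fin m → Finset ℕ
  nonempty : ∀ i, (set i).Nonempty

namespace SetFamily

/-- The total number of elements `N = ∑ |S_i|`. -/
def size (F : SetFamily) : ℕ := ∑ i, (F.set i).card

/-- All sets of the family are subsets of `[u] = {1, …, u}`. -/
def InUniverse (F : SetFamily) (u : ℕ) : Prop := ∀ i, F.set i ⊆ Finset.Icc 1 u

end SetFamily

/-! ### Random access machine with words of `O(log N)` bits

Structured programs over finitely many registers, with a read-only memory that holds the data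
structure and a working memory (initially zero) for the query. Every instruction and every test
costs one step. Words are natural numbers below a bound `B`; a program that would produce a
larger number, or read outside the data structure, does not have an execution. -/

namespace RAM

/-- Arithmetic and bitwise operations (`sub` is truncated at `0`, `div` rounds down). -/
inductive BinOp where
  | add | sub | mul | div | mod | and | or | xor | shl | shr

def BinOp.eval : BinOp → ℕ → ℕ → ℕ
  | .add, x, y => x + y
  | .sub, x, y => x - y
  | .mul, x, y => x * y
  | .div, x, y => x / y
  | .mod, x, y => x % y
  | .and, x, y => x &&& y
  | .or, x, y => x ||| y
  | .xor, x, y => x ^^^ y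
  | .shl, x, y => x <<< y
  | .shr, x, y => x >>> y

/-- Programs. The arguments `r`, `a`, `b` are names of registers. -/
inductive Prog where
  /-- `r := c` -/
  | const (r c : ℕ)
  /-- `r := a o b` -/
  | binop (o : BinOp) (r a b : ℕ)
  /-- `r := data[a]` -/
  | read (r a : ℕ)
  /-- `r := work[a]` -/
  | load (r a : ℕ)
  /-- `work[a] := r` -/
  | store (a r : ℕ)
  /-- first `p`, then `q` -/
  | seq (p q : Prog)
  /-- if `a ≠ 0` then `p` else `q` -/
  | ite (a : ℕ) (p q : Prog)
  /-- while `a ≠ 0` do `p` -/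
  | while (a : ℕ) (p : Prog)

/-- Contents of the registers and of the working memory. -/
structure State where
  reg : ℕ → ℕ
  work : ℕ → ℕ

def State.setReg (s : State) (r v : ℕ) : State := { s with reg := Function.update s.reg r v }

def State.setWork (s : State) (a v : ℕ) : State := { s with work := Function.update s.work a v }

/-- `Exec B data p s t s'`: started in state `s`, the program `p` halts after exactly `t` steps in
state `s'`, where words are numbers below `B` and `data` is the read-only memory. -/
inductive Exec (B : ℕ) (data : List ℕ) : Prog → State → ℕ → State → Prop where
  | const {r c : ℕ} {s : State} (h : c < B) :
      Exec B data (.const r c) s 1 (s.setReg r c)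
  | binop {o : BinOp} {r a b : ℕ} {s : State} (h : o.eval (s.reg a) (s.reg b) < B) :
      Exec B data (.binop o r a b) s 1 (s.setReg r (o.eval (s.reg a) (s.reg b)))
  | read {r a v : ℕ} {s : State} (h : data[s.reg a]? = some v) :
      Exec B data (.read r a) s 1 (s.setReg r v)
  | load {r a : ℕ} {s : State} :
      Exec B data (.load r a) s 1 (s.setReg r (s.work (s.reg a)))
  | store {a r : ℕ} {s : State} :
      Exec B data (.store a r) s 1 (s.setWork (s.reg a) (s.reg r))
  | seq {p q : Prog} {s s' s'' : State} {t t' : ℕ}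
      (hp : Exec B data p s t s') (hq : Exec B data q s' t' s'') :
      Exec B data (.seq p q) s (t + t') s''
  | iteTrue {a : ℕ} {p q : Prog} {s s' : State} {t : ℕ}
      (h : s.reg a ≠ 0) (hp : Exec B data p s t s') :
      Exec B data (.ite a p q) s (t + 1) s'
  | iteFalse {a : ℕ} {p q : Prog} {s s' : State} {t : ℕ}
      (h : s.reg a = 0) (hq : Exec B data q s t s') :
      Exec B data (.ite a p q) s (t + 1) s'
  | whileFalse {a : ℕ} {p : Prog} {s : State} (h : s.reg a = 0) :
      Exec B data (.while a p) s 1 s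
  | whileTrue {a : ℕ} {p : Prog} {s s' s'' : State} {t t' : ℕ}
      (h : s.reg a ≠ 0) (hp : Exec B data p s t s') (hw : Exec B data (.while a p) s' t' s'') :
      Exec B data (.while a p) s (t + t' + 1) s''

/-- The initial state on query `(i, j)`: `i` and `j` are in registers `0` and `1`, all other
registers and the working memory are zero. -/
def initState (i j : ℕ) : State where
  reg r := if r = 0 then i else if r = 1 then j else 0
  work _ := 0

end RAM

/-! ### Data structures for SetDisjointness -/

/-- A data structure: an (unrestricted) preprocessing map that turns an instance into a sequence
of words, and one fixed query program. On instances of total size `N` words are numbers below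
`(N + 2) ^ wordExp`, that is, they have `O(log N)` bits. -/
structure DataStructure where
  wordExp : ℕ
  preprocess : SetFamily → List ℕ
  query : RAM.Prog

namespace DataStructure

/-- The bound on words for the instance `F`. -/
def wordBound (D : DataStructure) (F : SetFamily) : ℕ := (F.size + 2) ^ D.wordExp

/-- The space used on the instance `F`, in words. -/
def space (D : DataStructure) (F : SetFamily) : ℕ := (D.preprocess F).length

/-- On query `(i, j)` the query program halts after exactly `t` steps with output `b`
(in register `0`). -/
def QueryResult (D : DataStructure) (F : SetFamily) (i j : Fin F.m) (t b : ℕ) : Prop :=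
  ∃ s : RAM.State,
    RAM.Exec (D.wordBound F) (D.preprocess F) D.query (RAM.initState i j) t s ∧ s.reg 0 = b

/-- `D` solves SetDisjointness on the instances in `P`: the stored numbers are words, and every
query `(i, j)` is answered by `1` if `S_i ∩ S_j = ∅` and by `0` otherwise. -/
def Solves (D : DataStructure) (P : Set SetFamily) : Prop :=
  ∀ F ∈ P, (∀ v ∈ D.preprocess F, v < D.wordBound F) ∧
    ∀ i j : Fin F.m, ∃ t, D.QueryResult F i j t (if Disjoint (F.set i) (F.set j) then 1 else 0)

/-- Every query on the instance `F` takes at most `T` steps. -/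
def QueryTimeLE (D : DataStructure) (F : SetFamily) (T : ℝ) : Prop :=
  ∀ (i j : Fin F.m) (t b : ℕ), D.QueryResult F i j t b → (t : ℝ) ≤ T

end DataStructure

/-- Strong SetDisjointness Conjecture: a data structure for SetDisjointness that answers queries in
time `T(N)` must use space `S(N) = Ω̃(N² / T(N)²)`. -/
def StrongSetDisjointnessConjecture : Prop :=
  ∀ (D : DataStructure) (S T : ℕ → ℝ), D.Solves Set.univ →
    (∀ F : SetFamily, (D.space F : ℝ) ≤ S F.size ∧ D.QueryTimeLE F (T F.size)) →
    ∃ (c : ℝ) (k : ℕ), 0 < c ∧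
      ∀ᶠ N : ℕ in atTop, c * ((N : ℝ) ^ 2 / T N ^ 2) / Real.log N ^ k ≤ S N

/-! If the theorem fails for `D`, then for infinitely many `N` the structure is both small and fast
on every instance of size `N` in `[u]`. Using it as a subroutine gives a structure for arbitrary
universes that contradicts the conjecture at those `N`.

Put `p = N^a` with `a` small and `t = √u / p²`. A set with at most about `t` elements is handled by
looking up each of its elements in a sorted dictionary of memberships, in time `O(t log N)`. At most
`N/t` sets remain. Hash these into `[u]` and give the images to `D`. Hashing never hides an
intersection, it only creates false ones. Two disjoint sets of size at most `s ≈ tp` collide with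
probability at most `s²/u = O(1/p²)`, so some hash function spoils only `O((N/t)²/p²)` of these
pairs (`exists_hash`). Pairs with a set larger than `s` number at most `O((N/t)·N/(tp))`. Hence
`O((N/t)²/p)` exceptional pairs suffice (`exists_reduction`); they go into the same dictionary, and
a hit flips the answer of `D`.

The assumed space bound for `D` on `O(N/t)` sets is also `O((N/t)²/p)`. So space `O(N²/(t² N^a))`
and time `O(t log N)` are achieved, and `N^a` beats every power of `log N`. At all other `N`, the
same query program runs on data that treats every set as small (`exists_encodes`), since the
conjecture asks for one structure on all instances. `exists_encoding` proves correctness of the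
actual RAM program. -/

namespace RAM

/-! ### Determinism and running-time triples -/

/-- `QueryTimeLE` speaks of all executions; determinism lets one exhibited execution settle it. -/
theorem Exec.deterministic {B : ℕ} {data : List ℕ} {p : Prog} {s s₁ s₂ : State} {t t' : ℕ}
    (h : Exec B data p s t s₁) (h' : Exec B data p s t' s₂) : t = t' ∧ s₁ = s₂ := by
  induction h generalizing t' s₂ with
  | const _ => cases h'; exact ⟨rfl, rfl⟩
  | binop _ => cases h'; exact ⟨rfl, rfl⟩
  | read h =>
    cases h' with
    | read h' =>
      rw [h] at h'
      cases h'
      exact ⟨rfl, rfl⟩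
  | load => cases h'; exact ⟨rfl, rfl⟩
  | store => cases h'; exact ⟨rfl, rfl⟩
  | seq _ _ ihp ihq =>
    cases h' with
    | seq hp hq =>
      obtain ⟨rfl, rfl⟩ := ihp hp
      obtain ⟨rfl, rfl⟩ := ihq hq
      exact ⟨rfl, rfl⟩
  | iteTrue h _ ih =>
    cases h' with
    | iteTrue _ hp => obtain ⟨rfl, rfl⟩ := ih hp; exact ⟨rfl, rfl⟩
    | iteFalse h0 _ => exact absurd h0 h
  | iteFalse h _ ih =>
    cases h' with
    | iteTrue h0 _ => exact absurd h h0
    | iteFalse _ hp => obtain ⟨rfl, rfl⟩ := ih hp; exact ⟨rfl, rfl⟩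
  | whileFalse h =>
    cases h' with
    | whileFalse _ => exact ⟨rfl, rfl⟩
    | whileTrue h0 _ _ => exact absurd h h0
  | whileTrue h _ _ ihp ihw =>
    cases h' with
    | whileFalse h0 => exact absurd h0 h
    | whileTrue _ hp hw =>
      obtain ⟨rfl, rfl⟩ := ihp hp
      obtain ⟨rfl, rfl⟩ := ihw hw
      exact ⟨rfl, rfl⟩

/-- Started in `s`, the program `p` halts after at most `T` steps in a state that satisfies `Q`. -/
def Runs (B : ℕ) (data : List ℕ) (p : Prog) (s : State) (T : ℕ) (Q : State → Prop) : Prop :=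
  ∃ t s', Exec B data p s t s' ∧ t ≤ T ∧ Q s'

namespace Runs

variable {B : ℕ} {data : List ℕ} {s : State} {T : ℕ} {Q : State → Prop}

theorem const {r c : ℕ} (h : c < B) (hQ : Q (s.setReg r c)) :
    Runs B data (.const r c) s 1 Q := ⟨_, _, .const h, le_rfl, hQ⟩

theorem binop {o : BinOp} {r a b : ℕ} (h : o.eval (s.reg a) (s.reg b) < B)
    (hQ : Q (s.setReg r (o.eval (s.reg a) (s.reg b)))) :
    Runs B data (.binop o r a b) s 1 Q := ⟨_, _, .binop h, le_rfl, hQ⟩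

theorem read {r a v : ℕ} (h : data[s.reg a]? = some v) (hQ : Q (s.setReg r v)) :
    Runs B data (.read r a) s 1 Q := ⟨_, _, .read h, le_rfl, hQ⟩

theorem seq {p q : Prog} {T₁ T₂ : ℕ} {P : State → Prop} (hp : Runs B data p s T₁ P)
    (hq : ∀ s', P s' → Runs B data q s' T₂ Q) : Runs B data (.seq p q) s (T₁ + T₂) Q := by
  obtain ⟨t, s', h, ht, hP⟩ := hp
  obtain ⟨t', s'', h', ht', hQ⟩ := hq s' hP
  exact ⟨_, _, .seq h h', by omega, hQ⟩

theorem mono {p : Prog} {T' : ℕ} {Q' : State → Prop} (h : Runs B data p s T Q) (hT : T ≤ T')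
    (hQ : ∀ s', Q s' → Q' s') : Runs B data p s T' Q' := by
  obtain ⟨t, s', h, ht, hP⟩ := h
  exact ⟨t, s', h, ht.trans hT, hQ _ hP⟩

theorem ite {a : ℕ} {p q : Prog} (hp : s.reg a ≠ 0 → Runs B data p s T Q)
    (hq : s.reg a = 0 → Runs B data q s T Q) : Runs B data (.ite a p q) s (T + 1) Q := by
  by_cases h : s.reg a = 0
  · obtain ⟨t, s', h', ht, hP⟩ := hq h
    exact ⟨_, _, .iteFalse h h', by omega, hP⟩
  · obtain ⟨t, s', h', ht, hP⟩ := hp h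
    exact ⟨_, _, .iteTrue h h', by omega, hP⟩

theorem while_zero {a : ℕ} {p : Prog} (h : s.reg a = 0) (hQ : Q s) :
    Runs B data (.while a p) s 1 Q := ⟨_, _, .whileFalse h, le_rfl, hQ⟩

theorem while_step {a : ℕ} {p : Prog} {T₁ T₂ : ℕ} {P : State → Prop} (h : s.reg a ≠ 0)
    (hp : Runs B data p s T₁ P) (hw : ∀ s', P s' → Runs B data (.while a p) s' T₂ Q) :
    Runs B data (.while a p) s (T₁ + T₂ + 1) Q := by
  obtain ⟨t, s', h₁, ht, hP⟩ := hp
  obtain ⟨t', s'', h₂, ht', hQ⟩ := hw s' hP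
  exact ⟨_, _, .whileTrue h h₁ h₂, by omega, hQ⟩

end Runs

/-! ### Relocating a program -/

/-- The program `p` with its registers moved up by `20`, working on the words of the data structure
at the multiples of the number in register `18`; register `19` is used for addresses. -/
def Prog.relocate : Prog → Prog
  | .const r c => .const (r + 20) c
  | .binop o r a b => .binop o (r + 20) (a + 20) (b + 20)
  | .read r a => .seq (.binop .mul 19 (a + 20) 18) (.read (r + 20) 19)
  | .load r a => .load (r + 20) (a + 20)
  | .store a r => .store (a + 20) (r + 20)
  | .seq p q => .seq p.relocate q.relocate
  | .ite a p q => .ite (a + 20) p.relocate q.relocate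
  | .while a p => .while (a + 20) p.relocate

/-- `σ` represents the state `s` in the registers from `20` on. -/
def Represents (σ s : State) : Prop := (∀ r, σ.reg (r + 20) = s.reg r) ∧ σ.work = s.work

theorem Represents.setReg {σ s : State} (h : Represents σ s) (r v : ℕ) :
    Represents (σ.setReg (r + 20) v) (s.setReg r v) := by
  refine ⟨fun x => ?_, h.2⟩
  by_cases hx : x = r
  · subst hx; simp [State.setReg]
  · simp [State.setReg, hx, h.1]

/-- The factor `2` comes from `read`, which becomes an address multiplication and a read. Working
memory is not shifted, so the surrounding program must leave it untouched. Registers below `19`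
survive the simulation. -/
theorem Exec.relocate {B B' : ℕ} {data data' : List ℕ} {k : ℕ} (hB : B ≤ B')
    (hdata : ∀ a v, data[a]? = some v → a * k < B' ∧ data'[a * k]? = some v)
    {p : Prog} {s s' : State} {t : ℕ} (h : Exec B data p s t s') {σ : State}
    (hσ : Represents σ s) (hk : σ.reg 18 = k) :
    Runs B' data' p.relocate σ (2 * t)
      (fun σ' => Represents σ' s' ∧ ∀ r < 19, σ'.reg r = σ.reg r) := by
  have hset : ∀ (τ : State) (r v x : ℕ), x < 19 → (τ.setReg (r + 20) v).reg x = τ.reg x := by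
    intro τ r v x hx
    have : x ≠ r + 20 := by omega
    simp [State.setReg, this]
  induction h generalizing σ with
  | const h =>
    exact (Runs.const (h.trans_le hB) ⟨hσ.setReg _ _, fun x hx => hset _ _ _ _ hx⟩).mono
      (by norm_num) fun _ h => h
  | @binop o r a b s h =>
    rw [← hσ.1 a, ← hσ.1 b] at h ⊢
    exact (Runs.binop (h.trans_le hB) ⟨hσ.setReg _ _, fun x hx => hset _ _ _ _ hx⟩).mono
      (by norm_num) fun _ h => h
  | @read r a v s h =>
    obtain ⟨h₁, h₂⟩ := hdata _ _ h
    refine Runs.seq (T₁ := 1) (T₂ := 1)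
      (P := fun τ => τ = σ.setReg 19 (s.reg a * k)) ?_ ?_
    · refine Runs.binop ?_ ?_ <;> simp [BinOp.eval, hσ.1, hk, h₁]
    · rintro _ rfl
      refine Runs.read (v := v) (by simpa [State.setReg] using h₂) ⟨?_, ?_⟩
      · refine Represents.setReg (s := s) ⟨fun x => ?_, hσ.2⟩ _ _
        simp [hσ.1]
      · intro x hx
        rw [hset _ _ _ _ hx]
        simp [State.setReg, hx.ne]
  | @load r a s =>
    refine ⟨1, _, .load, by norm_num, ?_⟩
    rw [hσ.1, hσ.2]
    exact ⟨hσ.setReg _ _, fun x hx => hset _ _ _ _ hx⟩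
  | @store a r s =>
    refine ⟨1, _, .store, by norm_num, ?_⟩
    rw [hσ.1, hσ.1]
    exact ⟨⟨hσ.1, by simp [State.setWork, hσ.2]⟩, fun x hx => rfl⟩
  | seq _ _ ihp ihq =>
    rw [mul_add]
    refine Runs.seq (ihp hσ hk) fun τ hτ => ?_
    refine (ihq hτ.1 (by rw [hτ.2 _ (by norm_num), hk])).mono le_rfl fun τ' h => ⟨h.1, ?_⟩
    exact fun r hr => (h.2 r hr).trans (hτ.2 r hr)
  | @iteTrue a p q s s' t h _ ih =>
    refine (Runs.ite (T := 2 * t) (fun _ => ih hσ hk) fun h0 => ?_).mono (by omega) fun _ h => h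
    exact absurd (hσ.1 a ▸ h0) h
  | @iteFalse a p q s s' t h _ ih =>
    refine (Runs.ite (T := 2 * t) (fun h0 => ?_) fun _ => ih hσ hk).mono (by omega) fun _ h => h
    exact absurd h (hσ.1 a ▸ h0)
  | @whileFalse a p s h =>
    exact (Runs.while_zero (by rw [hσ.1, h]) ⟨hσ, fun _ _ => rfl⟩).mono (by norm_num) fun _ h => h
  | @whileTrue a p s s' s'' t t' h _ _ ihp ihw =>
    refine (Runs.while_step (T₁ := 2 * t) (T₂ := 2 * t') (by rwa [hσ.1]) (ihp hσ hk)
      fun τ hτ => ?_).mono (by omega) fun _ h => h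
    refine (ihw hτ.1 (by rw [hτ.2 _ (by norm_num), hk])).mono le_rfl fun τ' h => ⟨h.1, ?_⟩
    exact fun r hr => (h.2 r hr).trans (hτ.2 r hr)

end RAM

/-! ### Interleaved arrays in the read-only memory. -/

namespace RAM

namespace Runs

variable {B : ℕ} {data : List ℕ} {s : State} {T : ℕ} {Q : State → Prop} {q : Prog}

theorem seq_const {r c : ℕ} (h : c < B) (hq : Runs B data q (s.setReg r c) T Q) :
    Runs B data (.seq (.const r c) q) s (1 + T) Q :=
  Runs.seq (Runs.const h (Q := fun s' => s' = s.setReg r c) rfl) (by rintro _ rfl; exact hq)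

theorem seq_binop {o : BinOp} {r a b : ℕ} (h : o.eval (s.reg a) (s.reg b) < B)
    (hq : Runs B data q (s.setReg r (o.eval (s.reg a) (s.reg b))) T Q) :
    Runs B data (.seq (.binop o r a b) q) s (1 + T) Q :=
  Runs.seq (Runs.binop h (Q := fun s' => s' = s.setReg r (o.eval (s.reg a) (s.reg b))) rfl)
    (by rintro _ rfl; exact hq)

end Runs

/-- The read-only memory holds the nine arrays `A 0, …, A 8` of length `L`, interleaved. -/
structure Holds (B : ℕ) (data : List ℕ) (A : ℕ → ℕ → ℕ) (L : ℕ) : Prop where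
  get : ∀ c < 9, ∀ a < L, data[a * 9 + c]? = some (A c a)
  lt : ∀ c < 9, ∀ a < L, A c a < B
  length_lt : 9 * L + 9 < B

/-- `r := A c a`, for the array number `c`. -/
def Prog.fetch (r a c : ℕ) : Prog :=
  .seq (.binop .mul 2 a 18) (.seq (.const 3 c) (.seq (.binop .add 2 2 3) (.read r 2)))

/-- The state after `Prog.fetch`. -/
def State.fetch (A : ℕ → ℕ → ℕ) (s : State) (r a c : ℕ) : State :=
  (((s.setReg 2 (s.reg a * 9)).setReg 3 c).setReg 2 (s.reg a * 9 + c)).setReg r (A c (s.reg a))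

section

variable {B : ℕ} {data : List ℕ} {A : ℕ → ℕ → ℕ} {L : ℕ} (hA : Holds B data A L)
include hA

theorem Holds.fetch {s : State} {r a c : ℕ} {Q : State → Prop} (h18 : s.reg 18 = 9) (hc : c < 9)
    (ha : s.reg a < L) (hQ : Q (s.fetch A r a c)) :
    Runs B data (.fetch r a c) s 4 Q := by
  have := hA.length_lt
  refine (Runs.seq_binop ?_ (Runs.seq_const ?_ (Runs.seq_binop ?_
    (Runs.read (v := A c (s.reg a)) ?_ ?_)))).mono (by norm_num) fun _ h => h
  · simp only [BinOp.eval, h18]; omega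
  · omega
  · simp [BinOp.eval, State.setReg, h18]; omega
  · simpa [BinOp.eval, State.setReg, h18] using hA.get c hc _ ha
  · simpa [BinOp.eval, State.setReg, h18, State.fetch] using hQ

theorem Holds.seq_fetch {s : State} {r a c T : ℕ} {Q : State → Prop} {q : Prog}
    (h18 : s.reg 18 = 9) (hc : c < 9) (ha : s.reg a < L)
    (hq : Runs B data q (s.fetch A r a c) T Q) :
    Runs B data (.seq (.fetch r a c) q) s (4 + T) Q :=
  Runs.seq (hA.fetch (Q := fun s' => s' = s.fetch A r a c) h18 hc ha rfl)
    (by rintro _ rfl; exact hq)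

end

/-! ### Binary search -/

/-- One step of the binary search for the key in register `10` in the array `A 6`. -/
def Prog.searchStep : Prog :=
  .seq (.binop .add 13 11 12) (.seq (.fetch 14 13 6) (.seq (.binop .sub 15 14 10)
    (.seq (.ite 15 (.const 3 0) (.binop .add 11 13 16)) (.binop .div 12 12 17))))

/-- Set register `8` to `1` if the key in register `10` occurs in the array `A 6`. -/
def Prog.lookup : Prog :=
  .seq (.const 11 0) (.seq (.fetch 12 16 8) (.seq (.while 12 Prog.searchStep)
    (.seq (.fetch 14 11 6) (.seq (.binop .sub 15 14 10) (.seq (.binop .sub 14 10 14)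
      (.seq (.binop .add 15 15 14) (.ite 15 (.const 3 0) (.const 8 1))))))))

/-- The two states agree but for the scratch registers of the search. -/
def State.Agree (s s' : State) : Prop :=
  s'.work = s.work ∧ ∀ r, r ≠ 2 → r ≠ 3 → (r < 11 ∨ 16 ≤ r) → s'.reg r = s.reg r

theorem State.Agree.trans {s s' s'' : State} (h : s.Agree s') (h' : s'.Agree s'') : s.Agree s'' :=
  ⟨h'.1.trans h.1, fun r h₂ h₃ hr => (h'.2 r h₂ h₃ hr).trans (h.2 r h₂ h₃ hr)⟩

/-- The array `A 6` is sorted on its first `2 ^ h` entries, and `A 8` holds half that number. -/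
structure Sorted (A : ℕ → ℕ → ℕ) (L h : ℕ) : Prop where
  mono : ∀ p q, p ≤ q → q < 2 ^ h → A 6 p ≤ A 6 q
  le : 2 ^ h ≤ L
  top : A 8 0 = 2 ^ h / 2

/-- The constants in registers `16`, `17` and `18`. -/
def State.Consts (s : State) : Prop := s.reg 16 = 0 ∧ s.reg 17 = 2 ∧ s.reg 18 = 9

theorem State.Consts.agree {s s' : State} (h : s.Consts) (h' : s.Agree s') : s'.Consts := by
  refine ⟨?_, ?_, ?_⟩ <;> rw [h'.2 _ (by norm_num) (by norm_num) (by norm_num)]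
  exacts [h.1, h.2.1, h.2.2]

/-- Invariant: the window starts at register `11` and has length `2 ^ k`, with half its length in
register `12`; a key present in the window stays present when the window is halved. The half length
becomes `0` exactly at length one, which ends the loop. Each round costs `9` steps and one test. -/
theorem runs_search {B : ℕ} {data : List ℕ} {A : ℕ → ℕ → ℕ} {L h : ℕ} (hA : Holds B data A L)
    (hS : Sorted A L h) (k : ℕ) (s : State) (hs : s.Consts) (hk : s.reg 12 = 2 ^ k / 2)
    (hpos : s.reg 11 + 2 ^ k ≤ 2 ^ h) (hkey : s.reg 10 < B) :
    Runs B data (.while 12 .searchStep) s (10 * k + 1) fun s' => s.Agree s' ∧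
      s'.reg 11 < 2 ^ h ∧ ((∃ q, s.reg 11 ≤ q ∧ q < s.reg 11 + 2 ^ k ∧ A 6 q = s.reg 10) →
        A 6 (s'.reg 11) = s.reg 10) := by
  have hL := hS.le
  have hB := hA.length_lt
  induction k generalizing s with
  | zero =>
    refine Runs.while_zero (by simpa using hk) ⟨⟨rfl, fun _ _ _ _ => rfl⟩, by simpa using hpos, ?_⟩
    rintro ⟨q, h₁, h₂, h₃⟩
    rwa [show s.reg 11 = q by simp at h₂; omega]
  | succ k ih =>
    have h2 : 2 ^ (k + 1) = 2 * 2 ^ k := by ring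
    have hk' : s.reg 12 = 2 ^ k := by rw [hk, h2]; simp
    have hp : 0 < 2 ^ k := by positivity
    obtain ⟨h16, h17, h18⟩ := hs
    have hlt : s.reg 11 + 2 ^ k < L := by omega
    have hv := hA.lt 6 (by norm_num) _ hlt
    refine (Runs.while_step (T₁ := 9) (T₂ := 10 * k + 1) (P := fun s' => s.Agree s' ∧
      s'.reg 12 = 2 ^ k / 2 ∧ s'.reg 11 = if A 6 (s.reg 11 + 2 ^ k) ≤ s.reg 10 then
        s.reg 11 + 2 ^ k else s.reg 11) (by omega) ?_ ?_).mono (by omega) fun _ h => h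
    · refine (Runs.seq_binop ?_ (hA.seq_fetch ?_ ?_ ?_ (Runs.seq_binop ?_
        (Runs.seq (T₁ := 2) (T₂ := 1) (P := fun s' => s.Agree s' ∧
      s'.reg 12 = 2 ^ k ∧ s'.reg 11 = if A 6 (s.reg 11 + 2 ^ k) ≤ s.reg 10 then
        s.reg 11 + 2 ^ k else s.reg 11) (Runs.ite ?_ ?_) ?_)))).mono
          (by norm_num) fun _ h => h
      · simp [BinOp.eval, hk']; omega
      · simp [State.setReg, h18]
      · norm_num
      · simp [BinOp.eval, State.setReg, hk']; omega
      · simp [BinOp.eval, State.setReg, State.fetch, hk']; omega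
      -- Register `15` holds a truncated difference, nonzero exactly when the probed entry exceeds
      -- the key. Writing to register `3` serves as a no-op.
      · intro hne
        refine Runs.const (by omega) ⟨⟨rfl, ?_⟩, ?_, ?_⟩
        · intro r _ _ _
          simp [BinOp.eval, State.setReg, State.fetch, Function.update_apply]
          grind
        · simp [BinOp.eval, State.setReg, State.fetch, hk']
        · simp [BinOp.eval, State.setReg, State.fetch, hk'] at hne ⊢
          omega
      · intro heq
        refine Runs.binop ?_ ⟨⟨rfl, ?_⟩, ?_, ?_⟩
        · simp [BinOp.eval, State.setReg, State.fetch, hk', h16]; omega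
        · intro r _ _ _
          simp [BinOp.eval, State.setReg, State.fetch, Function.update_apply]
          grind
        · simp [BinOp.eval, State.setReg, State.fetch, hk']
        · simp [BinOp.eval, State.setReg, State.fetch, hk', h16] at heq ⊢
          omega
      · rintro s' ⟨h₁, h₂, h₃⟩
        have h17' : s'.reg 17 = 2 := by rw [h₁.2 _ (by norm_num) (by norm_num) (by norm_num), h17]
        refine Runs.binop ?_ ⟨⟨h₁.1, ?_⟩, ?_, ?_⟩
        · simp only [BinOp.eval, h17', h₂]; omega
        · intro r r2 r3 hr
          rw [← h₁.2 r r2 r3 hr]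
          have : r ≠ 12 := by omega
          simp [State.setReg, this]
        · simp [BinOp.eval, State.setReg, h17', h₂]
        · simpa [State.setReg] using h₃
    · rintro s' ⟨h₁, h₂, h₃⟩
      have h10 : s'.reg 10 = s.reg 10 := h₁.2 _ (by norm_num) (by norm_num) (by norm_num)
      refine (ih s' (State.Consts.agree ⟨h16, h17, h18⟩ h₁) h₂ ?_ (by omega)).mono le_rfl ?_
      · split_ifs at h₃ <;> omega
      · rintro s'' ⟨g₁, g₂, g₃⟩
        refine ⟨h₁.trans g₁, g₂, ?_⟩
        rintro ⟨q, q₁, q₂, q₃⟩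
        rw [h10] at g₃
        apply g₃
        split_ifs at h₃ with hle
        · by_cases hq : s.reg 11 + 2 ^ k ≤ q
          · exact ⟨q, by omega, by omega, q₃⟩
          -- The key occurs left of the probe while the probed entry is at most the key: by
          -- monotonicity the probed entry is the key.
          · refine ⟨s.reg 11 + 2 ^ k, by omega, by omega, le_antisymm hle ?_⟩
            rw [← q₃]
            exact hS.mono _ _ (by omega) (by omega)
        · refine ⟨q, by omega, ?_, q₃⟩
          by_contra hq
          exact hle (q₃ ▸ hS.mono _ _ (by omega) (by omega))

/-- Register `8` is not reset on a miss, so repeated lookups accumulate a disjunction. Equality is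
tested by adding the two truncated differences. -/
theorem runs_lookup {B : ℕ} {data : List ℕ} {A : ℕ → ℕ → ℕ} {L h : ℕ} (hA : Holds B data A L)
    (hS : Sorted A L h) (s : State) (hs : s.Consts) (hkey : s.reg 10 < B) :
    Runs B data .lookup s (10 * h + 16) fun s' => s'.work = s.work ∧
      (∀ r, r ≠ 2 → r ≠ 3 → r ≠ 8 → (r < 11 ∨ 16 ≤ r) → s'.reg r = s.reg r) ∧
      ((∃ q < 2 ^ h, A 6 q = s.reg 10) → s'.reg 8 = 1) ∧
      ((¬ ∃ q < 2 ^ h, A 6 q = s.reg 10) → s'.reg 8 = s.reg 8) := by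
  have hL := hS.le
  have hB := hA.length_lt
  have hp : 0 < 2 ^ h := by positivity
  obtain ⟨h16, h17, h18⟩ := hs
  refine (Runs.seq_const (by omega) (hA.seq_fetch ?_ ?_ ?_ (Runs.seq
    (runs_search hA hS h _ ?_ ?_ ?_ ?_) (T₂ := 10) ?_))).mono (by omega) fun _ h => h
  · simp [State.setReg, h18]
  · norm_num
  · simp [State.setReg, h16]; omega
  · simp [State.Consts, State.fetch, State.setReg, h16, h17, h18]
  · simp [State.fetch, State.setReg, h16, hS.top]
  · simp [State.fetch, State.setReg]
  · simpa [State.fetch, State.setReg] using hkey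
  rintro s' ⟨h₁, h₂, h₃⟩
  have h₄ : s.Agree s' := by
    refine State.Agree.trans (s' := State.fetch A (s.setReg 11 0) 12 16 8)
      ⟨rfl, fun r r2 r3 hr => ?_⟩ h₁
    have : r ≠ 11 := by omega
    have : r ≠ 12 := by omega
    simp [State.fetch, State.setReg, *]
  have h10 : s'.reg 10 = s.reg 10 := h₄.2 _ (by norm_num) (by norm_num) (by norm_num)
  have h8 : s'.reg 8 = s.reg 8 := h₄.2 _ (by norm_num) (by norm_num) (by norm_num)
  have h18' : s'.reg 18 = 9 := by rw [h₄.2 _ (by norm_num) (by norm_num) (by norm_num), h18]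
  have hv := hA.lt 6 (by norm_num) (s'.reg 11) (by omega)
  have h₅ : (∃ q < 2 ^ h, A 6 q = s.reg 10) ↔ A 6 (s'.reg 11) = s.reg 10 := by
    refine ⟨?_, fun h => ⟨_, h₂, h⟩⟩
    rintro ⟨q, hq, hq'⟩
    simp only [State.fetch, State.setReg] at h₃
    simpa using h₃ ⟨q, by simp, by simpa using hq, by simpa using hq'⟩
  rw [h₅]
  refine (hA.seq_fetch h18' (by norm_num) (by omega) (Runs.seq_binop ?_ (Runs.seq_binop ?_
    (Runs.seq_binop ?_ (Runs.ite (T := 1) ?_ ?_))))).mono (by norm_num) fun _ h => h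
  · simp [State.fetch, State.setReg, BinOp.eval]; omega
  · simp [State.fetch, State.setReg, BinOp.eval]; omega
  · simp [State.fetch, State.setReg, BinOp.eval]; omega
  · intro hne
    have hne : A 6 (s'.reg 11) ≠ s.reg 10 := by
      simp [State.fetch, State.setReg, BinOp.eval] at hne
      omega
    refine Runs.const (by omega) ⟨h₄.1, fun r r2 r3 r8 hr => ?_, fun h => absurd h hne, fun _ => ?_⟩
    · rw [← h₄.2 r r2 r3 hr]
      have : r ≠ 14 := by omega
      have : r ≠ 15 := by omega
      simp [State.fetch, State.setReg, *]
    · simp [State.fetch, State.setReg, h8]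
  · intro heq
    have heq : A 6 (s'.reg 11) = s.reg 10 := by
      simp [State.fetch, State.setReg, BinOp.eval] at heq
      omega
    refine Runs.const (by omega) ⟨h₄.1, fun r r2 r3 r8 hr => ?_, fun _ => ?_, fun h => absurd heq h⟩
    · rw [← h₄.2 r r2 r3 hr]
      have : r ≠ 14 := by omega
      have : r ≠ 15 := by omega
      simp [State.fetch, State.setReg, *]
    · simp [State.setReg]

end RAM

namespace RAM

/-! ### The query program -/

/-- One step of the loop over the elements of a set: look up the key of the element at position
`6` for the set in register `1`. -/
def Prog.elementStep : Prog :=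
  .seq (.fetch 9 6 5) (.seq (.binop .mul 10 9 5) (.seq (.binop .add 10 10 1) (.seq .lookup
    (.seq (.const 3 1) (.seq (.binop .add 6 6 3) (.binop .sub 7 7 3))))))

/-- The time per round is `10 * h + 16` for the lookup, `9` for the other instructions and `1` for
the test. Working memory is preserved for the later run of the relocated program. -/
theorem runs_elements {B : ℕ} {data : List ℕ} {A : ℕ → ℕ → ℕ} {L h : ℕ} (hA : Holds B data A L)
    (hS : Sorted A L h) (n : ℕ) (s : State) (hs : s.Consts) (hn : s.reg 7 = n)
    (hL : s.reg 6 + n ≤ L)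
    (hkey : ∀ k < n, A 5 (s.reg 6 + k) * s.reg 5 + s.reg 1 < B)
    (h8 : s.reg 8 = 0 ∨ s.reg 8 = 1) :
    Runs B data (.while 7 .elementStep) s ((10 * h + 26) * n + 1) fun s' => s'.work = s.work ∧
      (∀ r, r ≠ 2 → r ≠ 3 → (r < 6 ∨ 16 ≤ r) → s'.reg r = s.reg r) ∧
      (s'.reg 8 = 0 ∨ s'.reg 8 = 1) ∧
      (s'.reg 8 = 1 ↔ s.reg 8 = 1 ∨ ∃ k < n, ∃ q < 2 ^ h,
        A 6 q = A 5 (s.reg 6 + k) * s.reg 5 + s.reg 1) := by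
  have hB := hA.length_lt
  induction n generalizing s with
  | zero => exact Runs.while_zero hn ⟨rfl, fun _ _ _ _ => rfl, h8, by simp⟩
  | succ n ih =>
    obtain ⟨h16, h17, h18⟩ := hs
    have hkey0 := hkey 0 (by omega)
    rw [add_zero] at hkey0
    refine (Runs.while_step (T₁ := 10 * h + 25) (T₂ := (10 * h + 26) * n + 1)
      (P := fun s' => s'.work = s.work ∧
        (∀ r, r ≠ 2 → r ≠ 3 → (r < 6 ∨ 16 ≤ r) → s'.reg r = s.reg r) ∧
        s'.reg 6 = s.reg 6 + 1 ∧ s'.reg 7 = n ∧ (s'.reg 8 = 0 ∨ s'.reg 8 = 1) ∧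
        (s'.reg 8 = 1 ↔ s.reg 8 = 1 ∨ ∃ q < 2 ^ h,
          A 6 q = A 5 (s.reg 6) * s.reg 5 + s.reg 1)) (by omega) ?_ ?_).mono (by linarith)
      fun _ h => h
    · refine (hA.seq_fetch h18 (by norm_num) (by omega) (Runs.seq_binop ?_ (Runs.seq_binop ?_
        (Runs.seq (runs_lookup hA hS _ ?_ ?_) (T₂ := 3) ?_)))).mono (by omega) fun _ h => h
      · simp [State.fetch, State.setReg, BinOp.eval]; omega
      · simpa [State.fetch, State.setReg, BinOp.eval] using hkey0
      · simp [State.Consts, State.fetch, State.setReg, BinOp.eval, h16, h17, h18]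
      · simpa [State.fetch, State.setReg, BinOp.eval] using hkey0
      rintro s' ⟨h₁, h₂, h₃, h₄⟩
      have h₅ : ∀ r, r ≠ 2 → r ≠ 3 → (r < 8 ∨ 16 ≤ r) → s'.reg r = s.reg r := by
        intro r r2 r3 hr
        rw [h₂ r r2 r3 (by omega) (by omega)]
        have : r ≠ 9 := by omega
        have : r ≠ 10 := by omega
        simp [State.fetch, State.setReg, *]
      have h6 := h₅ 6 (by norm_num) (by norm_num) (by norm_num)
      have h7 := h₅ 7 (by norm_num) (by norm_num) (by norm_num)
      simp [State.fetch, State.setReg, BinOp.eval] at h₃ h₄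
      refine (Runs.seq_const (by omega) (Runs.seq_binop ?_ (Runs.binop ?_ ?_))).mono
        (by norm_num) fun _ h => h
      · simp [State.setReg, BinOp.eval, h6]; omega
      · simp [State.setReg, BinOp.eval, h7]; omega
      · refine ⟨h₁, fun r r2 r3 hr => ?_, ?_, ?_, ?_, ?_⟩
        · rw [← h₅ r r2 r3 (by omega)]
          have : r ≠ 6 := by omega
          have : r ≠ 7 := by omega
          simp [State.setReg, *]
        · simp [State.setReg, BinOp.eval, h6]
        · simp [State.setReg, BinOp.eval, h7, hn]
        · simp only [State.setReg, BinOp.eval]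
          by_cases hq : ∃ q < 2 ^ h, A 6 q = A 5 (s.reg 6) * s.reg 5 + s.reg 1
          · obtain ⟨q, q₁, q₂⟩ := hq
            simp [h₃ q q₁ q₂]
          · push Not at hq
            simpa [h₄ hq] using h8
        · simp only [State.setReg, BinOp.eval]
          by_cases hq : ∃ q < 2 ^ h, A 6 q = A 5 (s.reg 6) * s.reg 5 + s.reg 1
          · obtain ⟨q, q₁, q₂⟩ := id hq
            simp [h₃ q q₁ q₂, hq]
          · simp only [hq, or_false]
            push Not at hq
            simp [h₄ hq]
    · rintro s' ⟨h₁, h₂, h6, h7, h8', h₃⟩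
      have e1 := h₂ 1 (by norm_num) (by norm_num) (by norm_num)
      have e5 := h₂ 5 (by norm_num) (by norm_num) (by norm_num)
      have hadd : ∀ k, s'.reg 6 + k = s.reg 6 + (k + 1) := fun k => by omega
      have hc : s'.Consts := by
        refine ⟨?_, ?_, ?_⟩ <;> rw [h₂ _ (by norm_num) (by norm_num) (by norm_num)] <;> assumption
      refine (ih s' hc h7 (by omega) (fun k hk => ?_) h8').mono le_rfl ?_
      · rw [hadd, e1, e5]; exact hkey _ (by omega)
      · rintro s'' ⟨g₁, g₂, g₃, g₄⟩
        refine ⟨g₁.trans h₁, fun r r2 r3 hr => (g₂ r r2 r3 hr).trans (h₂ r r2 r3 hr), g₃, ?_⟩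
        rw [g₄, h₃, e1, e5, or_assoc]
        refine or_congr_right ⟨?_, ?_⟩
        · rintro (h | ⟨k, hk, h⟩)
          · exact ⟨0, by omega, by simpa using h⟩
          · exact ⟨k + 1, by omega, by rwa [hadd] at h⟩
        · rintro ⟨_ | k, hk, h⟩
          · exact Or.inl (by simpa using h)
          · exact Or.inr ⟨k, by omega, by rwa [hadd]⟩

/-- The answer to the query given in registers `0` and `1`: the exclusive or of the result of the
loop over the elements of the first set and of the answer of `p` (if the first set is not marked
in `A 1`). -/
def Prog.answer (p : Prog) : Prog :=
  .seq (.fetch 5 16 7) (.seq (.fetch 6 0 3) (.seq (.fetch 7 0 4) (.seq (.while 7 .elementStep)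
    (.seq (.fetch 4 0 1) (.seq
      (.ite 4 (.const 9 1) (.seq (.fetch 20 0 2) (.seq (.fetch 21 1 2)
        (.seq p.relocate (.binop .add 9 20 16))))) (.binop .xor 0 9 8))))))

/-- The query program: exchange the two sets if the first one is not marked in `A 1`. -/
def Prog.wrap (p : Prog) : Prog :=
  .seq (.const 18 9) (.seq (.const 17 2) (.seq (.fetch 4 0 1) (.seq
    (.ite 4 (.const 3 0) (.seq (.binop .add 6 0 16) (.seq (.binop .add 0 1 16)
      (.binop .add 1 6 16)))) p.answer)))

/-- The bit `b` is the provisional answer "disjoint": constantly `1` for a marked set, the output of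
`p` otherwise. A dictionary hit flips it, meaning a common element in the first case and an
exceptional pair in the second. -/
theorem runs_answer {B B₀ : ℕ} {data data₀ : List ℕ} {A : ℕ → ℕ → ℕ} {L h : ℕ}
    (hA : Holds B data A L) (hS : Sorted A L h) (hB₀ : B₀ ≤ B)
    (h₀ : ∀ a v, data₀[a]? = some v → a < L ∧ A 0 a = v)
    {p : Prog} {s : State} (hs : s.Consts) (h8 : s.reg 8 = 0)
    (h20 : ∀ r, 20 ≤ r → s.reg r = 0) (hw : ∀ a, s.work a = 0)
    (hi : s.reg 0 < L) (hj : s.reg 1 < L) (hend : A 3 (s.reg 0) + A 4 (s.reg 0) ≤ L)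
    (hkey : ∀ k < A 4 (s.reg 0), A 5 (A 3 (s.reg 0) + k) * A 7 0 + s.reg 1 < B)
    {b t : ℕ} (hb : b = 0 ∨ b = 1) (hmark : A 1 (s.reg 0) ≠ 0 → b = 1)
    (hp : A 1 (s.reg 0) = 0 → ∃ s', Exec B₀ data₀ p (initState (A 2 (s.reg 0)) (A 2 (s.reg 1))) t s'
      ∧ s'.reg 0 = b) :
    Runs B data p.answer s ((10 * h + 26) * A 4 (s.reg 0) + 2 * t + 28) fun s' =>
      (s'.reg 0 = 0 ∨ s'.reg 0 = 1) ∧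
      (s'.reg 0 = 1 ↔ (¬ (b = 1 ↔ ∃ k < A 4 (s.reg 0), ∃ q < 2 ^ h,
        A 6 q = A 5 (A 3 (s.reg 0) + k) * A 7 0 + s.reg 1))) := by
  have hB := hA.length_lt
  have hbB : b < B := by omega
  obtain ⟨h16, h17, h18⟩ := hs
  refine (hA.seq_fetch h18 (by norm_num) (by omega) (hA.seq_fetch ?_ (by norm_num) ?_
    (hA.seq_fetch ?_ (by norm_num) ?_ (Runs.seq (runs_elements hA hS (A 4 (s.reg 0)) _ ?_ ?_ ?_
    ?_ ?_) (T₂ := 2 * t + 15) ?_)))).mono (by omega) fun _ h => h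
  any_goals simp [State.fetch, State.setReg, State.Consts, h16, h17, h18, h8, hi]
  · exact hend
  · exact hkey
  intro s' g₁ g₂ g₃ g₄
  have g₅ : ∀ r, r ≠ 2 → r ≠ 3 → (r < 5 ∨ 16 ≤ r) → s'.reg r = s.reg r := by
    intro r r2 r3 hr
    rw [g₂ r r2 r3 (by omega)]
    have : r ≠ 5 := by omega
    have : r ≠ 6 := by omega
    have : r ≠ 7 := by omega
    simp [*]
  have e0 := g₅ 0 (by norm_num) (by norm_num) (by norm_num)
  have e1 := g₅ 1 (by norm_num) (by norm_num) (by norm_num)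
  have e16 := g₅ 16 (by norm_num) (by norm_num) (by norm_num)
  have e18 := g₅ 18 (by norm_num) (by norm_num) (by norm_num)
  rw [h16] at e16
  rw [h18] at e18
  refine (hA.seq_fetch e18 (by norm_num) (by omega) (Runs.seq (T₁ := 2 * t + 10) (T₂ := 1)
    (P := fun τ => τ.reg 8 = s'.reg 8 ∧ τ.reg 9 = b) (Runs.ite (T := 2 * t + 9) ?_ ?_) ?_)).mono
    (by omega) fun _ h => h
  · intro hne
    refine (Runs.const (by omega) ⟨?_, ?_⟩).mono (by omega) fun _ h => h
    · simp [State.fetch, State.setReg]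
    · rw [hmark (by simpa [State.fetch, State.setReg, e0] using hne)]
      simp [State.setReg]
  · intro heq
    obtain ⟨σ, hσ, hσ'⟩ := hp (by simpa [State.fetch, State.setReg, e0] using heq)
    refine (hA.seq_fetch ?_ (by norm_num) ?_ (hA.seq_fetch ?_ (by norm_num) ?_ (Runs.seq
      (hσ.relocate (B' := B) (data' := data) (k := 9) hB₀ ?_ ?_ ?_) (T₂ := 1) ?_))).mono
      (by omega) fun _ h => h
    any_goals simp [State.fetch, State.setReg, e0, e1, e18, hi, hj]
    · intro a v hv
      obtain ⟨ha, rfl⟩ := h₀ a v hv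
      exact ⟨by omega, by simpa using hA.get 0 (by norm_num) a ha⟩
    -- The registers from `22` on and the working memory are still zero, so `p` starts in a genuine
    -- initial state.
    · refine ⟨fun r => ?_, ?_⟩
      · have := g₅ (r + 20) (by omega) (by omega) (by omega)
        rw [h20 _ (by omega)] at this
        rcases r with _ | _ | r
        · simp [initState]
        · simp [initState]
        · simp [initState, this]
      · funext a
        simp [initState, g₁, hw]
    · intro τ hτ hτ'
      have t20 := hτ.1 0
      have t16 := hτ' 16 (by norm_num)
      have t8 := hτ' 8 (by norm_num)
      simp [e16] at t16 t8 t20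
      refine Runs.binop ?_ ⟨?_, ?_⟩
      · simpa [BinOp.eval, t20, t16, hσ'] using hbB
      · simp [State.setReg, t8]
      · simp [State.setReg, BinOp.eval, t20, t16, hσ']
  · rintro τ ⟨t8, t9⟩
    refine Runs.binop ?_ ?_
    · simp only [BinOp.eval, t8, t9]
      rcases hb with rfl | rfl <;> rcases g₃ with g | g <;> rw [g] <;> simp <;> omega
    · simp only [State.setReg, BinOp.eval, Function.update_self, t8, t9]
      rw [← g₄]
      rcases hb with rfl | rfl <;> rcases g₃ with g | g <;> rw [g] <;> simp

theorem runs_wrap {B B₀ : ℕ} {data data₀ : List ℕ} {A : ℕ → ℕ → ℕ} {L h : ℕ}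
    (hA : Holds B data A L) (hS : Sorted A L h) (hB₀ : B₀ ≤ B)
    (h₀ : ∀ a v, data₀[a]? = some v → a < L ∧ A 0 a = v)
    {p : Prog} {i j i' j' : ℕ} (hi : i < L) (hj : j < L)
    (hij : i' = i ∧ j' = j ∧ A 1 i ≠ 0 ∨ i' = j ∧ j' = i ∧ A 1 i = 0)
    (hend : A 3 i' + A 4 i' ≤ L)
    (hkey : ∀ k < A 4 i', A 5 (A 3 i' + k) * A 7 0 + j' < B)
    {b t : ℕ} (hb : b = 0 ∨ b = 1) (hmark : A 1 i' ≠ 0 → b = 1)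
    (hp : A 1 i' = 0 → ∃ s', Exec B₀ data₀ p (initState (A 2 i') (A 2 j')) t s' ∧ s'.reg 0 = b) :
    Runs B data p.wrap (initState i j) ((10 * h + 26) * A 4 i' + 2 * t + 38) fun s' =>
      (s'.reg 0 = 0 ∨ s'.reg 0 = 1) ∧
      (s'.reg 0 = 1 ↔ (¬ (b = 1 ↔ ∃ k < A 4 i', ∃ q < 2 ^ h,
        A 6 q = A 5 (A 3 i' + k) * A 7 0 + j'))) := by
  have hB := hA.length_lt
  have main : ∀ s : State, s.Consts → s.reg 8 = 0 → (∀ r, 20 ≤ r → s.reg r = 0) →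
      (∀ a, s.work a = 0) → s.reg 0 = i' → s.reg 1 = j' →
      Runs B data p.answer s ((10 * h + 26) * A 4 i' + 2 * t + 28) fun s' =>
      (s'.reg 0 = 0 ∨ s'.reg 0 = 1) ∧
      (s'.reg 0 = 1 ↔ (¬ (b = 1 ↔ ∃ k < A 4 i', ∃ q < 2 ^ h,
        A 6 q = A 5 (A 3 i' + k) * A 7 0 + j'))) := by
    rintro s h₁ h₂ h₃ h₄ rfl rfl
    exact runs_answer hA hS hB₀ h₀ h₁ h₂ h₃ h₄ (by omega) (by omega) hend hkey hb hmark hp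
  refine (Runs.seq_const (by omega) (Runs.seq_const (by omega) (hA.seq_fetch ?_ (by norm_num) ?_
    (Runs.seq (T₁ := 4) (P := fun s => s.Consts ∧ s.reg 8 = 0 ∧ (∀ r, 20 ≤ r → s.reg r = 0) ∧
      (∀ a, s.work a = 0) ∧ s.reg 0 = i' ∧ s.reg 1 = j') (Runs.ite (T := 3) ?_ ?_)
      fun s hs => main s hs.1 hs.2.1 hs.2.2.1 hs.2.2.2.1 hs.2.2.2.2.1 hs.2.2.2.2.2)))).mono
    (by omega) fun _ h => h
  · simp [State.setReg]
  · simpa [State.setReg, initState] using hi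
  · intro hne
    have hne : A 1 i ≠ 0 := by simpa [State.fetch, State.setReg, initState] using hne
    obtain ⟨rfl, rfl, -⟩ | ⟨-, -, h⟩ := hij
    · refine (Runs.const (by omega) ⟨?_, ?_, ?_, ?_, ?_, ?_⟩).mono (by norm_num) fun _ h => h
      · simp [State.Consts, State.fetch, State.setReg, initState]
      · simp [State.fetch, State.setReg, initState]
      · intro r hr
        simp [State.fetch, State.setReg, initState, Function.update_apply]
        grind
      · simp [State.fetch, State.setReg, initState]
      · simp [State.fetch, State.setReg, initState]
      · simp [State.fetch, State.setReg, initState]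
    · exact absurd h hne
  · intro heq
    have heq : A 1 i = 0 := by simpa [State.fetch, State.setReg, initState] using heq
    obtain ⟨-, -, h⟩ | ⟨rfl, rfl, -⟩ := hij
    · exact absurd heq h
    · refine (Runs.seq_binop ?_ (Runs.seq_binop ?_ (Runs.binop ?_ ⟨?_, ?_, ?_, ?_, ?_, ?_⟩))).mono
        (by norm_num) fun _ h => h
      · simp [State.fetch, State.setReg, initState, BinOp.eval]; omega
      · simp [State.fetch, State.setReg, initState, BinOp.eval]; omega
      · simp [State.fetch, State.setReg, initState, BinOp.eval]; omega
      · simp [State.Consts, State.fetch, State.setReg, initState]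
      · simp [State.fetch, State.setReg, initState]
      · intro r hr
        simp [State.fetch, State.setReg, initState, Function.update_apply]
        grind
      · simp [State.fetch, State.setReg, initState]
      · simp [State.fetch, State.setReg, initState, BinOp.eval]
      · simp [State.fetch, State.setReg, initState, BinOp.eval]

end RAM

/-! ### Arrays -/

/-- The bounds on `start` and `elem` hold at unused positions too, because every stored number has
to be a word. -/
theorem exists_concatenation (m b : ℕ) (c : ℕ → ℕ) (f : ℕ → ℕ → ℕ)
    (hf : ∀ i < m, ∀ k < c i, f i k ≤ b) :
    ∃ start elem : ℕ → ℕ, (∀ i, start i ≤ ∑ i ∈ Finset.range m, c i) ∧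
      (∀ i < m, start i + c i ≤ ∑ i ∈ Finset.range m, c i) ∧
      (∀ i < m, ∀ k < c i, elem (start i + k) = f i k) ∧ ∀ p, elem p ≤ b := by
  induction m with
  | zero => exact ⟨fun _ => 0, fun _ => 0, by simp, by simp, by simp, by simp⟩
  | succ m ih =>
    obtain ⟨start, elem, h₁, h₂, h₃, h₄⟩ := ih fun i hi => hf i (by omega)
    set t := ∑ i ∈ Finset.range m, c i
    refine ⟨Function.update start m t,
      fun p => if p < t then elem p else if p - t < c m then f m (p - t) else 0, ?_, ?_, ?_, ?_⟩
    · intro i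
      have := h₁ i
      rw [Finset.sum_range_succ, Function.update_apply]
      split_ifs <;> omega
    · intro i hi
      rw [Finset.sum_range_succ]
      by_cases him : i = m
      · subst him; simp [t]
      · have := h₂ i (by omega)
        rw [Function.update_of_ne him]
        omega
    · intro i hi k hk
      by_cases him : i = m
      · subst him; simp [hk]
      · have := h₂ i (by omega)
        simp only [Function.update_of_ne him]
        rw [if_pos (by omega), h₃ i (by omega) k hk]
    · intro p
      simp only
      split_ifs with h h'
      · exact h₄ p
      · exact hf m (by omega) _ h'
      · omega

/-- The padding value `b` exceeds all keys, so it keeps the array sorted and is invisible to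
searches for keys below `b`. -/
theorem exists_sorted_array (K : Finset ℕ) (n b : ℕ) (hn : K.card ≤ n) (hb : ∀ k ∈ K, k < b) :
    ∃ a : ℕ → ℕ, Monotone a ∧ (∀ p, a p ≤ b) ∧ ∀ k < b, (∃ q < n, a q = k) ↔ k ∈ K := by
  have hfin : {x | x ∈ K}.Finite := K.finite_toSet
  have hcard : ∀ h : {x | x ∈ K}.Finite, h.toFinset.card = K.card := fun h => by congr 1; ext; simp
  have hmem : ∀ p < K.card, Nat.nth (· ∈ K) p ∈ K := fun p hp =>
    Nat.nth_mem p fun h => by rwa [hcard]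
  refine ⟨fun p => if p < K.card then Nat.nth (· ∈ K) p else b, ?_, ?_, ?_⟩
  · intro p q hpq
    simp only
    split_ifs with h₁ h₂
    · exact Nat.nth_le_nth' hpq fun h => by rwa [hcard]
    · exact (hb _ (hmem p h₁)).le
    · omega
    · exact le_rfl
  · intro p
    simp only
    split_ifs with h
    · exact (hb _ (hmem p h)).le
    · exact le_rfl
  · intro k hk
    constructor
    · rintro ⟨q, -, rfl⟩
      simp only at hk ⊢
      split_ifs at hk ⊢ with h
      · exact hmem q h
      · omega
    · intro hkK
      obtain ⟨q, hq, hqk⟩ := Nat.exists_lt_card_nth_eq (p := (· ∈ K)) hkK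
      have := hq hfin
      rw [hcard] at this
      exact ⟨q, by omega, by simp [this, hqk]⟩

theorem exists_pow_two_between (n : ℕ) : ∃ h, n ≤ 2 ^ h ∧ 2 ^ h ≤ 2 * n + 1 := by
  rcases Nat.eq_zero_or_pos n with rfl | hn
  · exact ⟨0, by simp⟩
  · refine ⟨Nat.log 2 n + 1, (Nat.lt_pow_succ_log_self (by norm_num) n).le, ?_⟩
    have := Nat.pow_log_le_self 2 hn.ne'
    rw [pow_succ]
    omega

theorem RAM.holds_interleave {B L : ℕ} {A : ℕ → ℕ → ℕ} (hlt : ∀ c < 9, ∀ a < L, A c a < B)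
    (hL : 9 * L + 9 < B) :
    RAM.Holds B ((List.range (9 * L)).map fun x => A (x % 9) (x / 9)) A L := by
  refine ⟨fun c hc a ha => ?_, hlt, hL⟩
  rw [List.getElem?_map, List.getElem?_range (by omega)]
  simp only [Option.map_some]
  rw [show (a * 9 + c) % 9 = c by omega, show (a * 9 + c) / 9 = a by omega]

/-! ### The dictionary and the encoding of an instance. -/

namespace SetFamily

theorem m_le_size (F : SetFamily) : F.m ≤ F.size := by
  calc F.m = ∑ _i : Fin F.m, 1 := by simp
    _ ≤ F.size := Finset.sum_le_sum fun i _ => (F.nonempty i).card_pos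

theorem card_le_size (F : SetFamily) (i : Fin F.m) : (F.set i).card ≤ F.size :=
  Finset.single_le_sum (f := fun i => (F.set i).card) (fun _ _ => Nat.zero_le _)
    (Finset.mem_univ i)

/-- Elements are arbitrary naturals and need not fit into a word; they are replaced by their
positions in the union of the family, which has at most `F.size` elements. -/
theorem exists_ranking (F : SetFamily) : ∃ f : ℕ → ℕ, ∀ i j, ∀ x ∈ F.set i, f x < F.size ∧
    ∀ y ∈ F.set j, f x = f y → x = y := by
  classical
  set X := Finset.univ.biUnion F.set
  have hX : X.card ≤ F.size := Finset.card_biUnion_le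
  have hmem : ∀ i, ∀ x ∈ F.set i, x ∈ X := fun i x hx =>
    Finset.mem_biUnion.2 ⟨i, Finset.mem_univ i, hx⟩
  refine ⟨fun x => if h : x ∈ X then X.equivFin ⟨x, h⟩ else 0, fun i j x hx => ⟨?_, ?_⟩⟩
  · simp only [hmem i x hx, dif_pos]
    exact (Fin.is_lt _).trans_le hX
  · intro y hy hxy
    simp only [hmem i x hx, hmem j y hy, dif_pos] at hxy
    simpa using X.equivFin.injective (Fin.ext hxy)

end SetFamily

theorem mul_add_inj_of_lt {M a a' j j' : ℕ} (hj : j < M) (hj' : j' < M)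
    (h : a * M + j = a' * M + j') : a = a' ∧ j = j' := by
  have h₁ := congrArg (· / M) h
  have h₂ := congrArg (· % M) h
  have hM : 0 < M := by omega
  simp only [Nat.mul_add_mod_self_right, Nat.mod_eq_of_lt hj, Nat.mod_eq_of_lt hj'] at h₂
  refine ⟨?_, h₂⟩
  subst h₂
  exact Nat.eq_of_mul_eq_mul_right hM (by omega)

/-- The extension by zero of a function on `Fin m`. -/
def Fin.extendZero {m : ℕ} (f : Fin m → ℕ) (a : ℕ) : ℕ := if h : a < m then f ⟨a, h⟩ else 0

@[simp] theorem Fin.extendZero_val {m : ℕ} (f : Fin m → ℕ) (i : Fin m) :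
    Fin.extendZero f i = f i := by simp [Fin.extendZero]

theorem Fin.extendZero_lt {m b : ℕ} {f : Fin m → ℕ} (hb : 0 < b) (hf : ∀ i, f i < b) (a : ℕ) :
    Fin.extendZero f a < b := by
  unfold Fin.extendZero
  split_ifs
  · exact hf _
  · exact hb

theorem Fin.exists_concatenation (m b : ℕ) (c : Fin m → ℕ) (f : Fin m → ℕ → ℕ)
    (hf : ∀ i, ∀ k < c i, f i k ≤ b) :
    ∃ start elem : ℕ → ℕ, (∀ i, start i ≤ ∑ i, c i) ∧ (∀ i : Fin m, start i + c i ≤ ∑ i, c i) ∧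
      (∀ i : Fin m, ∀ k < c i, elem (start i + k) = f i k) ∧ ∀ p, elem p ≤ b := by
  have hsum : ∑ i ∈ Finset.range m, Fin.extendZero c i = ∑ i, c i := by
    rw [Finset.sum_range]
    simp
  obtain ⟨start, elem, h₁, h₂, h₃, h₄⟩ := _root_.exists_concatenation m b (Fin.extendZero c)
    (fun i k => Fin.extendZero (fun j => f j k) i) (by
      intro i hi k hk
      have := Fin.extendZero_val c ⟨i, hi⟩
      have := Fin.extendZero_val (fun j => f j k) ⟨i, hi⟩
      simp_all)
  rw [hsum] at h₁ h₂
  refine ⟨start, elem, h₁, fun i => ?_, fun i k hk => ?_, h₄⟩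
  · simpa using h₂ i i.2
  · simpa using h₃ i i.2 k (by simpa using hk)

theorem dictionary_key_lt {N a j : ℕ} (ha : a < 2 * N) (hj : j < N) :
    a * (N + 1) + j < (N + 2) ^ 3 := by
  have : a * (N + 1) ≤ (2 * N) * (N + 1) := Nat.mul_le_mul_right _ ha.le
  calc a * (N + 1) + j < 2 * N * (N + 1) + N := by omega
    _ ≤ (N + 2) ^ 3 := by ring_nf; nlinarith [Nat.zero_le (N ^ 3), Nat.zero_le (N ^ 2)]

/-- The keys for the memberships in the family `F` and for the pairs in `E`. -/
theorem SetFamily.exists_dictionary (F : SetFamily) (E : Finset (Fin F.m × Fin F.m)) :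
    ∃ (rank : ℕ → ℕ) (K : Finset ℕ), K.card ≤ F.size + E.card ∧ (∀ k ∈ K, k < (F.size + 2) ^ 3) ∧
      (∀ i, ∀ x ∈ F.set i, rank x < F.size) ∧
      (∀ i j : Fin F.m, ∀ x ∈ F.set i, rank x * (F.size + 1) + j ∈ K ↔ x ∈ F.set j) ∧
      ∀ i j : Fin F.m, (F.size + i) * (F.size + 1) + j ∈ K ↔ (i, j) ∈ E := by
  classical
  obtain ⟨rank, hrank⟩ := F.exists_ranking
  set N := F.size with hN
  have hm : F.m ≤ N := F.m_le_size
  set M := N + 1 with hM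
  -- Leading digits below `N` are ranks of elements, those from `N` on are indices of sets, so the
  -- two kinds of keys never clash.
  set K : Finset ℕ := (Finset.univ.biUnion fun j => (F.set j).image fun x => rank x * M + j) ∪
    E.image fun e => (N + e.1) * M + e.2 with hK
  have hKcard : K.card ≤ N + E.card := by
    refine (Finset.card_union_le _ _).trans (add_le_add ?_ Finset.card_image_le)
    exact Finset.card_biUnion_le.trans (Finset.sum_le_sum fun i _ => Finset.card_image_le)
  have hKb : ∀ k ∈ K, k < (N + 2) ^ 3 := by
    intro k hk
    simp only [hK, Finset.mem_union, Finset.mem_biUnion, Finset.mem_univ, true_and,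
      Finset.mem_image] at hk
    obtain ⟨j, x, hx, rfl⟩ | ⟨e, -, rfl⟩ := hk
    · have := (hrank j j x hx).1
      exact dictionary_key_lt (by omega) (by omega)
    · exact dictionary_key_lt (by omega) (by omega)
  have hK₁ : ∀ i j : Fin F.m, ∀ x ∈ F.set i, rank x * M + j ∈ K ↔ x ∈ F.set j := by
    intro i j x hx
    simp only [hK, Finset.mem_union, Finset.mem_biUnion, Finset.mem_univ, true_and,
      Finset.mem_image]
    constructor
    · rintro (⟨j', y, hy, h⟩ | ⟨e, -, h⟩)
      · obtain ⟨h₁, h₂⟩ := mul_add_inj_of_lt (by omega) (by omega) h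
        rw [← Fin.ext h₂, ← (hrank j' i y hy).2 x hx h₁]
        exact hy
      · have := (mul_add_inj_of_lt (by omega) (by omega) h).1
        have := (hrank i i x hx).1
        omega
    · exact fun hx' => Or.inl ⟨j, x, hx', rfl⟩
  have hK₂ : ∀ i j : Fin F.m, (N + i) * M + j ∈ K ↔ (i, j) ∈ E := by
    intro i j
    simp only [hK, Finset.mem_union, Finset.mem_biUnion, Finset.mem_univ, true_and,
      Finset.mem_image]
    constructor
    · rintro (⟨j', y, hy, h⟩ | ⟨e, he, h⟩)
      · have := (mul_add_inj_of_lt (by omega) (by omega) h).1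
        have := (hrank j' j' y hy).1
        omega
      · obtain ⟨h₁, h₂⟩ := mul_add_inj_of_lt (by omega) (by omega) h
        rwa [show (i, j) = e from Prod.ext (Fin.ext (Nat.add_left_cancel h₁).symm) (Fin.ext h₂.symm)]
    · exact fun he => Or.inr ⟨(i, j), he, rfl⟩
  exact ⟨rank, K, hKcard, hKb, fun i x hx => (hrank i i x hx).1, hK₁, hK₂⟩

/-- A data structure for SetDisjointness on `F`: `p` together with `data₀` answers the queries for
pairs of sets that are not small, up to the exceptions in `E`; all other queries are answered by
searching for the elements of a small set. -/
theorem exists_encoding (w : ℕ) (p : RAM.Prog) (F : SetFamily) (small : Fin F.m → Prop)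
    (E : Finset (Fin F.m × Fin F.m)) (idx : Fin F.m → ℕ)
    (hidx : ∀ i, idx i ≤ F.size) (data₀ : List ℕ) (hdata₀ : ∀ v ∈ data₀, v < (F.size + 2) ^ w)
    (hlen : data₀.length ≤ (F.size + 2) ^ 4) (τ t₀ : ℕ) (hτ : 1 ≤ τ)
    (hsmall : ∀ i, small i → (F.set i).card ≤ τ)
    (hp : ∀ i j, ¬ small i → ¬ small j → ∃ t s', t ≤ t₀ ∧
      RAM.Exec ((F.size + 2) ^ w) data₀ p (RAM.initState (idx i) (idx j)) t s' ∧
      (s'.reg 0 = 0 ∨ s'.reg 0 = 1) ∧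
      (s'.reg 0 = 1 ↔ (Disjoint (F.set i) (F.set j) ↔ (i, j) ∉ E))) :
    ∃ (data : List ℕ) (h : ℕ), 2 ^ h ≤ 2 * (F.size + 2) ^ 2 ∧
      (∀ v ∈ data, v < (F.size + 2) ^ (w + 12)) ∧
      data.length ≤ 9 * (data₀.length + 4 * (F.size + E.card + 1)) ∧
      ∀ i j : Fin F.m, ∃ t s', t ≤ (10 * h + 26) * τ + 2 * t₀ + 38 ∧
        RAM.Exec ((F.size + 2) ^ (w + 12)) data p.wrap (RAM.initState i j) t s' ∧
        s'.reg 0 = if Disjoint (F.set i) (F.set j) then 1 else 0 := by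
  classical
  obtain ⟨rank, K, hKcard, hKb, hrank, hK₁, hK₂⟩ := F.exists_dictionary E
  set N := F.size with hN
  have hm : F.m ≤ N := F.m_le_size
  set M := N + 1 with hM
  have hEcard : E.card ≤ N * N := by
    calc E.card ≤ Fintype.card (Fin F.m × Fin F.m) := Finset.card_le_univ _
      _ = F.m * F.m := by simp
      _ ≤ N * N := Nat.mul_le_mul hm hm
  have hN2 : 2 ≤ N + 2 := by omega
  set b := (N + 2) ^ 3 with hb
  have hkeyb : ∀ a j, a < 2 * N → j < N → a * M + j < b := fun a j => dictionary_key_lt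
  obtain ⟨h, hh, hh'⟩ := exists_pow_two_between K.card
  obtain ⟨dict, dict_mono, dict_le, hdict⟩ := exists_sorted_array K (2 ^ h) b hh hKb
  -- the lists of elements
  set c : Fin F.m → ℕ := fun i => if small i then (F.set i).card else 1 with hc
  -- A set that is not small gets the single pseudo-element `N + i`. The same search loop then tests
  -- membership of the pair in `E`.
  set f : Fin F.m → ℕ → ℕ := fun i k =>
    if small i then rank ((F.set i).toList.getD k 0) else N + i with hf
  have hget : ∀ i, ∀ k < (F.set i).card, (F.set i).toList.getD k 0 ∈ F.set i := by
    intro i k hk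
    rw [List.getD_eq_getElem _ _ (by simpa using hk)]
    exact Finset.mem_toList.1 (List.getElem_mem _)
  have hflt : ∀ i, ∀ k < c i, f i k < 2 * N := by
    intro i k hk
    simp only [hc, hf] at hk ⊢
    split_ifs at hk ⊢ with hi
    · have := hrank i _ (hget i k hk)
      omega
    · omega
  obtain ⟨start, elem, start_le, start_add, helem, elem_le⟩ :=
    Fin.exists_concatenation F.m (2 * N) c f fun i k hk => (hflt i k hk).le
  have hccard : ∀ i, c i ≤ (F.set i).card := by
    intro i
    simp only [hc]
    split_ifs
    · exact le_rfl
    · exact (F.nonempty i).card_pos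
  have htotal : ∑ i, c i ≤ N := Finset.sum_le_sum fun i _ => hccard i
  set A : ℕ → ℕ → ℕ := fun n a => match n with
    | 0 => data₀.getD a 0
    | 1 => Fin.extendZero (fun i => if small i then 1 else 0) a
    | 2 => Fin.extendZero idx a
    | 3 => start a
    | 4 => Fin.extendZero c a
    | 5 => elem a
    | 6 => dict a
    | 7 => M
    | 8 => 2 ^ h / 2
    | _ => 0 with hAdef
  set L := data₀.length + 4 * (N + E.card + 1) with hL
  set B := (N + 2) ^ (w + 12) with hB
  have hbase : (N + 2) ^ w ≤ B := Nat.pow_le_pow_right (by omega) (by omega)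
  have hsq : N + E.card + 1 ≤ (N + 2) ^ 2 := by nlinarith
  have hLB : 9 * L + 9 < (N + 2) ^ 12 := by
    have h₁ : 2 ^ 2 ≤ (N + 2) ^ 2 := Nat.pow_le_pow_left hN2 2
    have h₂ : 2 ^ 4 ≤ (N + 2) ^ 4 := Nat.pow_le_pow_left hN2 4
    have h₃ : 2 ^ 6 ≤ (N + 2) ^ 6 := Nat.pow_le_pow_left hN2 6
    calc 9 * L + 9 < 2 ^ 6 * (N + 2) ^ 4 := by
          have : (N + 2) ^ 4 = (N + 2) ^ 2 * (N + 2) ^ 2 := by ring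
          nlinarith
      _ ≤ (N + 2) ^ 6 * (N + 2) ^ 4 := Nat.mul_le_mul_right _ h₃
      _ = (N + 2) ^ 10 := by ring
      _ ≤ (N + 2) ^ 12 := Nat.pow_le_pow_right (by omega) (by norm_num)
  have hB12 : (N + 2) ^ 12 ≤ B := Nat.pow_le_pow_right (by omega) (by omega)
  have hbB : b < B := Nat.pow_lt_pow_right (by omega) (by omega)
  have hNB : 2 * N + 2 < B := by omega
  have hhL : 2 ^ h ≤ L := by omega
  have hlt : ∀ n < 9, ∀ a < L, A n a < B := by
    intro n hn a ha
    interval_cases n <;> simp only [hAdef]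
    · by_cases ha : a < data₀.length
      · rw [List.getD_eq_getElem _ _ ha]
        exact (hdata₀ _ (List.getElem_mem _)).trans_le hbase
      · rw [List.getD_eq_default _ _ (by omega)]
        omega
    · refine Fin.extendZero_lt (by omega) (fun i => ?_) a
      split_ifs <;> omega
    · exact Fin.extendZero_lt (by omega) (fun i => by have := hidx i; omega) a
    · have := start_le a; omega
    · refine Fin.extendZero_lt (by omega) (fun i => ?_) a
      have := hccard i
      have := F.card_le_size i
      omega
    · have := elem_le a; omega
    · exact (dict_le a).trans_lt hbB
    · omega
    · omega
  have hA := RAM.holds_interleave hlt (by omega)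
  have hS : RAM.Sorted A L h := ⟨fun p q hpq _ => dict_mono hpq, hhL, rfl⟩
  refine ⟨(List.range (9 * L)).map fun x => A (x % 9) (x / 9), h, by omega, ?_, by simp, ?_⟩
  · intro v hv
    obtain ⟨x, hx, rfl⟩ := List.mem_map.1 hv
    rw [List.mem_range] at hx
    exact hlt _ (Nat.mod_lt _ (by norm_num)) _ (by omega)
  intro i j
  obtain ⟨i', j', hij⟩ : ∃ i' j' : Fin F.m, i' = i ∧ j' = j ∧ small i ∨
      i' = j ∧ j' = i ∧ ¬ small i := by
    by_cases hi : small i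
    · exact ⟨i, j, Or.inl ⟨rfl, rfl, hi⟩⟩
    · exact ⟨j, i, Or.inr ⟨rfl, rfl, hi⟩⟩
  have hdisj : Disjoint (F.set i) (F.set j) ↔ Disjoint (F.set i') (F.set j') := by
    obtain ⟨rfl, rfl, -⟩ | ⟨rfl, rfl, -⟩ := hij
    · rfl
    · exact disjoint_comm
  -- After the exchange the first set is small as soon as either set is.
  have hns : ¬ small i' → ¬ small j' := by
    obtain ⟨rfl, rfl, h⟩ | ⟨rfl, rfl, h⟩ := hij
    · exact fun h' => absurd h h'
    · exact fun _ => h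
  obtain ⟨β, t, ht, hβ, hβs, hexec, hβn⟩ : ∃ β t : ℕ, t ≤ t₀ ∧ (β = 0 ∨ β = 1) ∧
      (small i' → β = 1) ∧ (¬ small i' → ∃ s', RAM.Exec ((N + 2) ^ w) data₀ p
        (RAM.initState (idx i') (idx j')) t s' ∧ s'.reg 0 = β) ∧
      (¬ small i' → (β = 1 ↔ (Disjoint (F.set i') (F.set j') ↔ (i', j') ∉ E))) := by
    by_cases hi : small i'
    · exact ⟨1, 0, by omega, Or.inr rfl, fun _ => rfl, fun h => absurd hi h, fun h => absurd hi h⟩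
    · obtain ⟨t, s', ht, he, h₁, h₂⟩ := hp i' j' hi (hns hi)
      exact ⟨_, t, ht, h₁, fun h => absurd h hi, fun _ => ⟨s', he, rfl⟩, fun _ => h₂⟩
  have hA1 : ∀ i : Fin F.m, A 1 i = if small i then 1 else 0 := fun i =>
    Fin.extendZero_val (fun i => if small i then 1 else 0) i
  have hA2 : ∀ i : Fin F.m, A 2 i = idx i := Fin.extendZero_val idx
  have hA4 : ∀ i : Fin F.m, A 4 i = c i := Fin.extendZero_val c
  have hA5 : ∀ k < A 4 i', A 5 (A 3 i' + k) = f i' k := fun k hk =>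
    helem i' k (by rwa [hA4] at hk)
  have hkey : ∀ k < A 4 i', A 5 (A 3 i' + k) * A 7 0 + j' < b := by
    intro k hk
    rw [hA5 k hk]
    exact hkeyb _ _ (hflt i' k (by rwa [hA4] at hk)) (by omega)
  have hrun := RAM.runs_wrap hA hS hbase (data₀ := data₀) (p := p) (i := i) (j := j) (i' := i')
    (j' := j') (b := β) (t := t) ?_ (by omega) (by omega) ?_ ?_ ?_ hβ ?_ ?_
  · obtain ⟨t', s', he, ht', h01, hans⟩ := hrun
    refine ⟨t', s', ht'.trans ?_, he, ?_⟩
    · have hcτ : A 4 i' ≤ τ := by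
        rw [hA4]
        simp only [hc]
        split_ifs with hi
        · exact hsmall _ hi
        · exact hτ
      have := Nat.mul_le_mul_left (10 * h + 26) hcτ
      omega
    · have hfound : (∃ k < A 4 i', ∃ q < 2 ^ h, A 6 q = A 5 (A 3 i' + k) * A 7 0 + j') ↔
          if small i' then ¬ Disjoint (F.set i') (F.set j') else (i', j') ∈ E := by
        have hdict : ∀ k < b, (∃ q < 2 ^ h, A 6 q = k) ↔ k ∈ K := hdict
        have h₁ : (∃ k < A 4 i', ∃ q < 2 ^ h, A 6 q = A 5 (A 3 i' + k) * A 7 0 + j') ↔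
            ∃ k < c i', f i' k * M + j' ∈ K := by
          constructor
          · rintro ⟨k, hk, hq⟩
            rw [hdict _ (hkey k hk), hA5 k hk] at hq
            exact ⟨k, by rwa [hA4] at hk, hq⟩
          · rintro ⟨k, hk, hq⟩
            rw [← hA4] at hk
            refine ⟨k, hk, ?_⟩
            rw [hdict _ (hkey k hk), hA5 k hk]
            exact hq
        rw [h₁]
        simp only [hc, hf]
        split_ifs with hi
        · rw [Finset.not_disjoint_iff]
          constructor
          · rintro ⟨k, hk, h⟩
            exact ⟨_, hget i' k hk, (hK₁ i' j' _ (hget i' k hk)).1 h⟩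
          · rintro ⟨x, hx, hx'⟩
            obtain ⟨k, hk, rfl⟩ := List.mem_iff_getElem.1 (Finset.mem_toList.2 hx)
            refine ⟨k, by simpa using hk, ?_⟩
            rw [List.getD_eq_getElem _ _ hk]
            exact (hK₁ i' j' _ hx).2 hx'
        · rw [← hK₂]
          exact ⟨fun ⟨_, _, h⟩ => h, fun h => ⟨0, by norm_num, h⟩⟩
      have hfinal : s'.reg 0 = 1 ↔ Disjoint (F.set i) (F.set j) := by
        rw [hans, hfound, hdisj]
        split_ifs with hi
        · simp [hβs hi]
        · rw [hβn hi]
          by_cases h₁ : Disjoint (F.set i') (F.set j') <;> by_cases h₂ : (i', j') ∈ E <;>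
            simp [h₁, h₂]
      split_ifs with hd
      · exact hfinal.2 hd
      · exact h01.resolve_right fun h => hd (hfinal.1 h)
  · intro a v hv
    obtain ⟨ha, rfl⟩ := List.getElem?_eq_some_iff.1 hv
    exact ⟨by omega, List.getD_eq_getElem _ _ ha⟩
  · rw [hA1]
    obtain ⟨rfl, rfl, h⟩ | ⟨rfl, rfl, h⟩ := hij
    · exact Or.inl (by simp [h])
    · exact Or.inr (by simp [h])
  · rw [hA4]
    exact (start_add i').trans (by omega)
  · exact fun k hk => (hkey k hk).trans hbB
  · intro hne
    rw [hA1] at hne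
    exact hβs (by by_contra h; simp [h] at hne)
  · intro heq
    rw [hA1] at heq
    rw [hA2, hA2]
    exact hexec fun h => by simp [h] at heq

/-! ### Reducing the universe -/

/-- Overwriting the value at `x` of a colliding `g` by an arbitrary `c` is injective: `c` is read
off at `x`, and the lost value `g x` equals `g y`. -/
theorem mul_card_collision_le {α : Type*} [Fintype α] [DecidableEq α] (u : ℕ) {x y : α}
    (hxy : x ≠ y) : u * (Finset.univ.filter fun g : α → Fin u => g x = g y).card ≤
      Fintype.card (α → Fin u) := by
  rw [mul_comm]
  calc _ = ((Finset.univ.filter fun g : α → Fin u => g x = g y) ×ˢ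
        (Finset.univ : Finset (Fin u))).card := by simp
    _ ≤ (Finset.univ : Finset (α → Fin u)).card := by
        refine Finset.card_le_card_of_injOn (fun p => Function.update p.1 x p.2)
          (fun _ _ => Finset.mem_coe.2 (Finset.mem_univ _)) ?_
        rintro ⟨g, c⟩ hg ⟨g', c'⟩ hg' h
        simp only [Finset.coe_product, Finset.coe_filter, Set.mem_prod, Set.mem_ofPred_eq,
          Finset.mem_univ, true_and] at hg hg'
        have hx : c = c' := by simpa using congrFun h x
        have hne : ∀ z, z ≠ x → g z = g' z := fun z hz => by simpa [hz] using congrFun h z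
        refine Prod.ext (funext fun z => ?_) hx
        by_cases hz : z = x
        · subst hz
          change g z = g' z
          rw [hg.1, hg'.1]
          exact hne y hxy.symm
        · exact hne z hz
    _ = _ := rfl

/-- Some function to `[u]` makes few of the given disjoint pairs of sets intersect. -/
theorem exists_hash {ι : Type*} (P : Finset ι) (A B : ι → Finset ℕ) {s u : ℕ} (hu : 1 ≤ u)
    (hA : ∀ e ∈ P, (A e).card ≤ s) (hB : ∀ e ∈ P, (B e).card ≤ s)
    (hAB : ∀ e ∈ P, Disjoint (A e) (B e)) :
    ∃ h : ℕ → ℕ, (∀ x, h x ∈ Finset.Icc 1 u) ∧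
      u * (P.filter fun e => ¬ Disjoint ((A e).image h) ((B e).image h)).card ≤ P.card * s ^ 2 := by
  classical
  -- Only finitely many elements occur, so one can average over a finite space of functions.
  obtain ⟨n, hn⟩ : ∃ n : ℕ, ∀ e ∈ P, ∀ x ∈ A e ∪ B e, x < n := by
    refine ⟨(P.biUnion fun e => A e ∪ B e).sup id + 1, fun e he x hx => Nat.lt_succ_of_le ?_⟩
    exact Finset.le_sup (f := id) (Finset.mem_biUnion.2 ⟨e, he, hx⟩)
  let H : (Fin n → Fin u) → ℕ → ℕ := fun g x => if hx : x < n then g ⟨x, hx⟩ + 1 else 1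
  have hne : Nonempty (Fin n → Fin u) := ⟨fun _ => ⟨0, hu⟩⟩
  have hpair : ∀ e ∈ P, u * (Finset.univ.filter fun g : Fin n → Fin u =>
      ¬ Disjoint ((A e).image (H g)) ((B e).image (H g))).card ≤
        s ^ 2 * Fintype.card (Fin n → Fin u) := by
    intro e he
    have hsub : (Finset.univ.filter fun g : Fin n → Fin u =>
        ¬ Disjoint ((A e).image (H g)) ((B e).image (H g))) ⊆
        (A e ×ˢ B e).biUnion fun p => Finset.univ.filter fun g => H g p.1 = H g p.2 := by
      intro g hg
      simp only [Finset.mem_filter, Finset.mem_univ, true_and, Finset.not_disjoint_iff,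
        Finset.mem_image] at hg
      obtain ⟨_, ⟨x, hx, rfl⟩, y, hy, h⟩ := hg
      exact Finset.mem_biUnion.2 ⟨(x, y), Finset.mem_product.2 ⟨hx, hy⟩, by simp [h]⟩
    -- Union bound over the at most `s ^ 2` pairs of elements.
    calc _ ≤ u * ∑ p ∈ A e ×ˢ B e, (Finset.univ.filter fun g => H g p.1 = H g p.2).card :=
          Nat.mul_le_mul_left _ ((Finset.card_le_card hsub).trans Finset.card_biUnion_le)
      _ = ∑ p ∈ A e ×ˢ B e, u * (Finset.univ.filter fun g => H g p.1 = H g p.2).card :=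
          Finset.mul_sum _ _ _
      _ ≤ ∑ p ∈ A e ×ˢ B e, Fintype.card (Fin n → Fin u) := by
          refine Finset.sum_le_sum fun p hp => ?_
          obtain ⟨hx, hy⟩ := Finset.mem_product.1 hp
          have hx' := hn e he _ (Finset.mem_union_left _ hx)
          have hy' := hn e he _ (Finset.mem_union_right _ hy)
          have hxy : (⟨p.1, hx'⟩ : Fin n) ≠ ⟨p.2, hy'⟩ := fun h =>
            Finset.disjoint_left.1 (hAB e he) hx (by rw [Fin.mk.inj_iff.1 h]; exact hy)
          refine le_of_eq_of_le ?_ (mul_card_collision_le u hxy)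
          congr 2
          ext g
          simp [H, hx', hy', Fin.ext_iff]
      _ = (A e).card * (B e).card * Fintype.card (Fin n → Fin u) := by simp
      _ ≤ _ := by
          rw [sq]
          exact Nat.mul_le_mul_right _ (Nat.mul_le_mul (hA e he) (hB e he))
  have hsum : ∑ g : Fin n → Fin u,
      u * (P.filter fun e => ¬ Disjoint ((A e).image (H g)) ((B e).image (H g))).card ≤
      ∑ _g : Fin n → Fin u, P.card * s ^ 2 := by
    calc _ = ∑ e ∈ P, u * (Finset.univ.filter fun g : Fin n → Fin u =>
          ¬ Disjoint ((A e).image (H g)) ((B e).image (H g))).card := by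
          simp only [Finset.card_filter, Finset.mul_sum]
          exact Finset.sum_comm
      _ ≤ ∑ e ∈ P, s ^ 2 * Fintype.card (Fin n → Fin u) := Finset.sum_le_sum hpair
      _ = _ := by simp; ring
  -- Some function does at least as well as the average.
  obtain ⟨g, -, hg⟩ := Finset.exists_le_of_sum_le Finset.univ_nonempty hsum
  refine ⟨H g, fun x => ?_, hg⟩
  simp only [H, Finset.mem_Icc]
  split_ifs with hx
  · have := (g ⟨x, hx⟩).2
    omega
  · omega

/-! ### Moving an instance into `[u]` without changing its size. -/

namespace SetFamily

/-- The family of the sets in a list. -/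
def ofList (l : List (Finset ℕ)) (hl : ∀ A ∈ l, A.Nonempty) : SetFamily where
  m := l.length
  set i := l[i]
  nonempty i := hl _ (List.getElem_mem _)

theorem size_ofList (l : List (Finset ℕ)) (hl : ∀ A ∈ l, A.Nonempty) :
    (ofList l hl).size = (l.map Finset.card).sum := by
  change ∑ i : Fin l.length, (l[i]).card = _
  exact Fin.sum_univ_fun_getElem l Finset.card

/-- Sets that fill up a family. -/
theorem exists_padding {u : ℕ} (hu : 1 ≤ u) (r : ℕ) : ∃ l : List (Finset ℕ),
    (∀ A ∈ l, A.Nonempty ∧ A ⊆ Finset.Icc 1 u) ∧ (l.map Finset.card).sum = r ∧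
      l.length ≤ r / u + 1 := by
  refine ⟨List.replicate (r / u) (Finset.Icc 1 u) ++
    if r % u = 0 then [] else [Finset.Icc 1 (r % u)], ?_, ?_, ?_⟩
  · intro A hA
    rcases List.mem_append.1 hA with h | h
    · rw [List.eq_of_mem_replicate h]
      exact ⟨⟨1, by simp [hu]⟩, subset_rfl⟩
    · split_ifs at h with h0
      · simp at h
      · rw [List.mem_singleton.1 h]
        exact ⟨⟨1, by simp; omega⟩, Finset.Icc_subset_Icc_right (Nat.mod_lt _ hu).le⟩
  · have := Nat.div_add_mod' r u
    split_ifs with h0 <;> simp <;> omega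
  · split_ifs <;> simp

theorem mul_card_filter_le (F : SetFamily) (a : ℕ) :
    a * (Finset.univ.filter fun i => a < (F.set i).card).card ≤ F.size := by
  rw [mul_comm, ← smul_eq_mul]
  refine (Finset.card_nsmul_le_sum _ (fun i => (F.set i).card) a ?_).trans
    (Finset.sum_le_univ_sum_of_nonneg fun _ => Nat.zero_le _)
  exact fun i hi => (Finset.mem_filter.1 hi).2.le

/-- A family of the same size in the universe `[u]` that contains the images under `h` of the sets
with more than `τ` elements. -/
theorem exists_image (F : SetFamily) {τ u : ℕ} (hτ : 1 ≤ τ) (hu : 1 ≤ u) {h : ℕ → ℕ}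
    (hh : ∀ x, h x ∈ Finset.Icc 1 u) : ∃ F' : SetFamily, F'.size = F.size ∧ F'.InUniverse u ∧
      F'.m ≤ F.size / τ + F.size / u + 1 ∧
      ∀ i, τ < (F.set i).card → ∃ i' : Fin F'.m, F'.set i' = (F.set i).image h := by
  classical
  set I := Finset.univ.filter fun i => τ < (F.set i).card with hI
  set l₁ := I.toList.map fun i => (F.set i).image h with hl₁
  have hsum₁ : (l₁.map Finset.card).sum = ∑ i ∈ I, ((F.set i).image h).card := by
    rw [hl₁, List.map_map]
    exact Finset.sum_map_toList I _
  have hle : (l₁.map Finset.card).sum ≤ F.size := by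
    rw [hsum₁]
    exact (Finset.sum_le_sum fun i _ => Finset.card_image_le).trans
      (Finset.sum_le_univ_sum_of_nonneg fun _ => Nat.zero_le _)
  -- Small sets are dropped and images may shrink. Padding restores the exact size, on which the
  -- universe `u F.size` and the word bound depend.
  obtain ⟨l₂, hl₂, hsum₂, hlen₂⟩ := exists_padding hu (F.size - (l₁.map Finset.card).sum)
  have hmem : ∀ A ∈ l₁ ++ l₂, A.Nonempty ∧ A ⊆ Finset.Icc 1 u := by
    intro A hA
    rcases List.mem_append.1 hA with hA | hA
    · obtain ⟨i, -, rfl⟩ := List.mem_map.1 hA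
      exact ⟨(F.nonempty i).image _, Finset.image_subset_iff.2 fun x _ => hh x⟩
    · exact hl₂ A hA
  refine ⟨ofList (l₁ ++ l₂) fun A hA => (hmem A hA).1, ?_, ?_, ?_, ?_⟩
  · rw [size_ofList, List.map_append, List.sum_append, hsum₂]
    omega
  · exact fun i => (hmem _ (List.getElem_mem _)).2
  · change (l₁ ++ l₂).length ≤ _
    have h₁ : l₁.length ≤ F.size / τ := by
      rw [Nat.le_div_iff_mul_le hτ, mul_comm]
      simpa [hl₁] using F.mul_card_filter_le τ
    have h₂ := Nat.div_le_div_right (c := u) (Nat.sub_le F.size (l₁.map Finset.card).sum)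
    rw [List.length_append]
    omega
  · intro i hi
    have : (F.set i).image h ∈ l₁ ++ l₂ :=
      List.mem_append_left _ (List.mem_map.2 ⟨i, by simp [hI, hi], rfl⟩)
    obtain ⟨k, hk, hk'⟩ := List.mem_iff_getElem.1 this
    exact ⟨⟨k, hk⟩, hk'⟩

/-- The reduction to the universe `[u]`, with a set `E` of exceptional pairs. -/
theorem exists_reduction (F : SetFamily) {τ s u : ℕ} (hτ : 1 ≤ τ) (hu : 1 ≤ u) :
    ∃ (F' : SetFamily) (E : Finset (Fin F.m × Fin F.m)) (n₁ n₂ n₃ : ℕ), F'.size = F.size ∧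
      F'.InUniverse u ∧ F'.m ≤ F.size / τ + F.size / u + 1 ∧
      τ * n₁ ≤ F.size ∧ s * n₂ ≤ F.size ∧ u * n₃ ≤ n₁ ^ 2 * s ^ 2 ∧
      E.card ≤ 2 * (n₁ * n₂) + n₃ ∧
      ∃ idx : Fin F.m → Fin F'.m → Prop,
      (∀ i, τ < (F.set i).card → ∃ i', idx i i') ∧
      ∀ i j i' j', τ < (F.set i).card → τ < (F.set j).card → idx i i' → idx j j' →
        (Disjoint (F'.set i') (F'.set j') ↔ (Disjoint (F.set i) (F.set j) ↔ (i, j) ∉ E)) := by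
  classical
  set I₁ := Finset.univ.filter fun i => τ < (F.set i).card with hI₁
  set I₂ := Finset.univ.filter fun i => s < (F.set i).card with hI₂
  set P := (I₁ ×ˢ I₁).filter fun e => (F.set e.1).card ≤ s ∧ (F.set e.2).card ≤ s ∧
    Disjoint (F.set e.1) (F.set e.2) with hP
  obtain ⟨h, hh, hbad⟩ := exists_hash P (fun e => F.set e.1) (fun e => F.set e.2) (s := s) hu
    (fun e he => (Finset.mem_filter.1 he).2.1) (fun e he => (Finset.mem_filter.1 he).2.2.1)
    (fun e he => (Finset.mem_filter.1 he).2.2.2)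
  obtain ⟨F', h₁, h₂, h₃, h₄⟩ := F.exists_image hτ hu hh
  set E := (I₁ ×ˢ I₁).filter fun e => Disjoint (F.set e.1) (F.set e.2) ∧
    ¬ Disjoint ((F.set e.1).image h) ((F.set e.2).image h) with hE
  refine ⟨F', E, I₁.card, I₂.card, _, h₁, h₂, h₃, F.mul_card_filter_le τ,
    F.mul_card_filter_le s, hbad.trans (Nat.mul_le_mul_right _ ?_), ?_,
    fun i i' => F'.set i' = (F.set i).image h, h₄, ?_⟩
  · exact (Finset.card_filter_le _ _).trans (by rw [Finset.card_product, sq])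
  -- Pairs with a set larger than `s` are counted wholesale; the others are charged to the hash
  -- function.
  · have hsub : E ⊆ (I₁ ×ˢ I₂ ∪ I₂ ×ˢ I₁) ∪
        P.filter fun e => ¬ Disjoint ((F.set e.1).image h) ((F.set e.2).image h) := by
      intro e he
      simp only [hE, hP, hI₁, hI₂, Finset.mem_filter, Finset.mem_union, Finset.mem_product,
        Finset.mem_univ, true_and] at he ⊢
      by_cases h₁ : s < (F.set e.1).card
      · exact Or.inl (Or.inr ⟨h₁, he.1.2⟩)
      · by_cases h₂ : s < (F.set e.2).card
        · exact Or.inl (Or.inl ⟨he.1.1, h₂⟩)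
        · exact Or.inr ⟨⟨he.1, by omega, by omega, he.2.1⟩, he.2.2⟩
    refine (Finset.card_le_card hsub).trans ((Finset.card_union_le _ _).trans ?_)
    refine Nat.add_le_add_right ((Finset.card_union_le _ _).trans ?_) _
    rw [Finset.card_product, Finset.card_product]
    linarith [mul_comm I₁.card I₂.card]
  · intro i j i' j' hi hj hi' hj'
    rw [hi', hj']
    have hmem : (i, j) ∈ E ↔ Disjoint (F.set i) (F.set j) ∧
        ¬ Disjoint ((F.set i).image h) ((F.set j).image h) := by
      simp [hE, hI₁, hi, hj]
    have himp : Disjoint ((F.set i).image h) ((F.set j).image h) →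
        Disjoint (F.set i) (F.set j) := by
      intro hd
      rw [Finset.disjoint_left] at hd ⊢
      exact fun x hx hx' => hd (Finset.mem_image_of_mem h hx) (Finset.mem_image_of_mem h hx')
    rw [hmem]
    tauto

end SetFamily

/-! ### Space and time of the resulting data structure. -/

namespace DataStructure

/-- `data` is a correct encoding of the instance `F` for the program `D.query.wrap`, of length at
most `ℓ` and with at most `T` steps for a query. -/
def Encodes (D : DataStructure) (F : SetFamily) (data : List ℕ) (ℓ T : ℝ) : Prop :=
  (∀ v ∈ data, v < (F.size + 2) ^ (D.wordExp + 12)) ∧ (data.length : ℝ) ≤ ℓ ∧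
    ∀ i j : Fin F.m, ∃ (t : ℕ) (s' : RAM.State), (t : ℝ) ≤ T ∧
      RAM.Exec ((F.size + 2) ^ (D.wordExp + 12)) data D.query.wrap (RAM.initState i j) t s' ∧
      s'.reg 0 = if Disjoint (F.set i) (F.set j) then 1 else 0

theorem lower_bound (D : DataStructure) (hSSDC : StrongSetDisjointnessConjecture)
    {S T : ℕ → ℝ} (h : ∀ F : SetFamily, ∃ data, D.Encodes F data (S F.size) (T F.size)) :
    ∃ (c : ℝ) (k : ℕ), 0 < c ∧
      ∀ᶠ N : ℕ in atTop, c * ((N : ℝ) ^ 2 / T N ^ 2) / Real.log N ^ k ≤ S N := by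
  choose pre hpre using h
  refine hSSDC ⟨D.wordExp + 12, pre, D.query.wrap⟩ S T ?_ fun F => ⟨(hpre F).2.1, ?_⟩
  · refine fun F _ => ⟨(hpre F).1, fun i j => ?_⟩
    obtain ⟨t, s', -, he, h⟩ := (hpre F).2.2 i j
    exact ⟨t, s', he, h⟩
  · rintro i j t b ⟨s, hs, -⟩
    obtain ⟨t', s', ht', he, -⟩ := (hpre F).2.2 i j
    rwa [(hs.deterministic he).1]

/-- Fallback for sizes at which nothing is assumed about `D`: every set counts as small, so
`D.query` is never run. Any finite bounds depending only on the size suffice. -/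
theorem exists_encodes (D : DataStructure) : ∃ S T : ℕ → ℝ, ∀ F : SetFamily,
    ∃ data, D.Encodes F data (S F.size) (T F.size) := by
  refine ⟨fun N => ((9 * (4 * (N + 1)) : ℕ) : ℝ),
    fun N => (((10 * (2 * (N + 2) ^ 2) + 26) * (N + 1) + 38 : ℕ) : ℝ), fun F => ?_⟩
  obtain ⟨data, h, h₁, h₂, h₃, h₄⟩ := exists_encoding D.wordExp D.query F (fun _ => True) ∅
    (fun _ => 0) (by simp) [] (by simp) (by simp) (F.size + 1) 0 (by omega)
    (fun i _ => (F.card_le_size i).trans (by omega)) (by simp)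
  refine ⟨data, h₂, by simpa using (Nat.cast_le (α := ℝ)).2 h₃, fun i j => ?_⟩
  obtain ⟨t, s', ht, he⟩ := h₄ i j
  refine ⟨t, s', ?_, he⟩
  have hh : h ≤ 2 * (F.size + 2) ^ 2 := Nat.lt_two_pow_self.le.trans h₁
  have : t ≤ (10 * (2 * (F.size + 2) ^ 2) + 26) * (F.size + 1) + 38 :=
    ht.trans (by
      have := Nat.mul_le_mul_right (F.size + 1)
        (show 10 * h + 26 ≤ 10 * (2 * (F.size + 2) ^ 2) + 26 by omega)
      omega)
  exact Nat.cast_le.2 this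

theorem query_time_le {N h : ℕ} {C t τ f : ℝ} (hN : (2 : ℝ) ≤ N) (hC : 0 ≤ C) (ht : 1 ≤ t)
    (hτ₀ : 0 ≤ τ) (hτ : τ ≤ 2 * t) (hf : f ≤ C * t) (hh : 2 ^ h ≤ 2 * (N + 2) ^ 2) :
    (10 * h + 26) * τ + 2 * f + 38 ≤ (380 + 4 * C) * (t * Real.log N) := by
  have hlog2 : (1 : ℝ) / 2 ≤ Real.log 2 := by linarith [Real.log_two_gt_d9]
  have hlogN : Real.log 2 ≤ Real.log N := Real.log_le_log (by norm_num) hN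
  have hh' : (h : ℝ) ≤ 10 * Real.log N := by
    have h₁ : (2 : ℝ) ^ h ≤ 2 * (N + 2) ^ 2 := by exact_mod_cast hh
    have h₂ : (2 : ℝ) ^ h ≤ (N : ℝ) ^ 5 := by
      calc (2 : ℝ) ^ h ≤ 2 * (N + 2) ^ 2 := h₁
        _ ≤ 2 * (N + N) ^ 2 := by gcongr
        _ = 2 ^ 3 * N ^ 2 := by ring
        _ ≤ N ^ 3 * N ^ 2 := by gcongr
        _ = N ^ 5 := by ring
    have h₃ := Real.log_le_log (by positivity) h₂
    rw [Real.log_pow, Real.log_pow] at h₃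
    push_cast at h₃
    have h₄ := mul_le_mul_of_nonneg_left hlog2 (Nat.cast_nonneg (α := ℝ) h)
    linarith
  have h2 : 1 ≤ 2 * Real.log N := by linarith
  have h3 : 1 ≤ t * (2 * Real.log N) := one_le_mul_of_one_le_of_one_le ht h2
  have h4 : C * t ≤ C * t * (2 * Real.log N) := le_mul_of_one_le_right (by positivity) h2
  calc (10 * h + 26) * τ + 2 * f + 38
      ≤ (10 * (10 * Real.log N) + 26 * (2 * Real.log N)) * (2 * t) + 2 * (C * t) + 38 := by
        gcongr
        linarith
    _ ≤ (380 + 4 * C) * (t * Real.log N) := by linarith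

/-- The relation `t ^ 2 * p ^ 4 = u N` is chosen for the choice `s ≈ t * p`: pairs of moderate sets
collide with probability `O(1 / p ^ 2)`, and the sets above `s` number a factor `p` fewer than `N /
t`. -/
theorem exists_encodes_of_bounds (D : DataStructure) {u : ℕ → ℕ}
    (hD : D.Solves {F | F.InUniverse (u F.size)}) {N : ℕ} (hN : 2 ≤ N) {C t p : ℝ} (hC : 0 ≤ C)
    (ht : 1 ≤ t) (hp : 1 ≤ p) (hu : t ^ 2 * p ^ 4 = u N) (huN : u N ≤ N)
    (hCN : 9 * C ≤ (N : ℝ) ^ 2)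
    (hbound : ∀ F' : SetFamily, F'.size = N → F'.InUniverse (u N) → (F'.m : ℝ) ≤ 3 * (N / t) →
      (D.space F' : ℝ) ≤ 9 * C * ((N / t) ^ 2 / p) ∧ D.QueryTimeLE F' (C * t))
    (F : SetFamily) (hF : F.size = N) :
    ∃ data, D.Encodes F data ((81 * C + 288) * ((N / t) ^ 2 / p))
      ((380 + 4 * C) * (t * Real.log N)) := by
  classical
  have hN' : (2 : ℝ) ≤ N := by exact_mod_cast hN
  have huN' : (u N : ℝ) ≤ N := by exact_mod_cast huN
  have ht0 : 0 < t := by linarith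
  have hp0 : 0 < p := by linarith
  set X : ℝ := (N / t) ^ 2 / p with hX
  have hp4 : 1 ≤ p ^ 4 := one_le_pow₀ hp
  have ht2u : t ^ 2 ≤ u N := by rw [← hu]; nlinarith [sq_nonneg t]
  have htu : t ≤ u N := by nlinarith
  have hu1 : 1 ≤ u N := by
    have : (1 : ℝ) ≤ u N := ht.trans htu
    exact_mod_cast this
  have htN : t ≤ N := htu.trans huN'
  -- The linear cost of storing the instance itself is absorbed, because `t ^ 2 * p ≤ u N ≤ N`.
  have hXN : (N : ℝ) ≤ X := by
    rw [hX, div_pow, div_div, le_div_iff₀ (by positivity), sq (N : ℝ)]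
    refine mul_le_mul_of_nonneg_left ?_ (by linarith)
    calc (t ^ 2 * p : ℝ) ≤ t ^ 2 * p ^ 4 := by
          refine mul_le_mul_of_nonneg_left ?_ (by positivity)
          exact le_self_pow₀ hp (by norm_num)
      _ ≤ (N : ℝ) := by rw [hu]; exact huN'
  have hX2 : X ≤ (N : ℝ) ^ 2 := by
    refine (div_le_self (by positivity) hp).trans ?_
    gcongr
    exact div_le_self (by linarith) ht
  set τ := ⌊t⌋₊ + 1 with hτ
  set s := ⌊t * p⌋₊ + 1 with hs
  have hτ₁ : t ≤ τ := by rw [hτ]; push_cast; exact (Nat.lt_floor_add_one t).le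
  have hτ₂ : (τ : ℝ) ≤ 2 * t := by
    rw [hτ]; push_cast; linarith [Nat.floor_le ht0.le]
  have hs₁ : t * p ≤ s := by rw [hs]; push_cast; exact (Nat.lt_floor_add_one _).le
  have hs₂ : (s : ℝ) ≤ 2 * (t * p) := by
    have : 1 ≤ t * p := one_le_mul_of_one_le_of_one_le ht hp
    rw [hs]; push_cast; linarith [Nat.floor_le (show 0 ≤ t * p by positivity)]
  obtain ⟨F', E, n₁, n₂, n₃, hsize, huniv, hm, hn₁, hn₂, hn₃, hE, idx, hidx, hcorrect⟩ :=
    F.exists_reduction (τ := τ) (s := s) (u := u N) (by omega) hu1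
  rw [hF] at hm hn₁ hn₂ hsize
  have hn₁' : (n₁ : ℝ) ≤ N / t := by
    rw [le_div_iff₀ ht0]
    have : (τ : ℝ) * n₁ ≤ N := by exact_mod_cast hn₁
    nlinarith [Nat.cast_nonneg (α := ℝ) n₁]
  have hn₂' : (n₂ : ℝ) ≤ N / (t * p) := by
    rw [le_div_iff₀ (by positivity)]
    have : (s : ℝ) * n₂ ≤ N := by exact_mod_cast hn₂
    nlinarith [Nat.cast_nonneg (α := ℝ) n₂]
  have hn₃' : (n₃ : ℝ) ≤ 4 * X := by
    have h₁ : (u N : ℝ) * n₃ ≤ n₁ ^ 2 * s ^ 2 := by exact_mod_cast hn₃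
    have h₂ : (n₁ : ℝ) ^ 2 * s ^ 2 ≤ (N / t) ^ 2 * (2 * (t * p)) ^ 2 := by gcongr
    have h₃ : (N / t) ^ 2 * (2 * (t * p)) ^ 2 = u N * (4 * ((N / t) ^ 2 / p ^ 2)) := by
      rw [← hu]; field_simp; norm_num
    have h₄ : (n₃ : ℝ) ≤ 4 * ((N / t) ^ 2 / p ^ 2) := by
      refine le_of_mul_le_mul_left ?_ (show (0 : ℝ) < u N by linarith)
      linarith
    refine h₄.trans ?_
    rw [hX]
    gcongr
    exact le_self_pow₀ hp two_ne_zero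
  have hE' : (E.card : ℝ) ≤ 6 * X := by
    have h₁ : (E.card : ℝ) ≤ 2 * (n₁ * n₂) + n₃ := by exact_mod_cast hE
    have h₂ : (n₁ : ℝ) * n₂ ≤ N / t * (N / (t * p)) := by gcongr
    have h₃ : N / t * (N / (t * p)) = X := by rw [hX]; field_simp
    linarith
  have hm' : (F'.m : ℝ) ≤ 3 * (N / t) := by
    have h₁ : (F'.m : ℝ) ≤ ((N / τ : ℕ) : ℝ) + ((N / u N : ℕ) : ℝ) + 1 := by exact_mod_cast hm
    have h₂ : ((N / τ : ℕ) : ℝ) ≤ N / t := Nat.cast_div_le.trans (by gcongr)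
    have h₃ : ((N / u N : ℕ) : ℝ) ≤ N / t := Nat.cast_div_le.trans (by gcongr)
    have h₄ : 1 ≤ N / t := (one_le_div ht0).2 htN
    linarith
  obtain ⟨hspace, htime⟩ := hbound F' hsize huniv hm'
  obtain ⟨hwords, hquery⟩ := hD F' (by rw [Set.mem_ofPred_eq, hsize]; exact huniv)
  have hlen : (D.preprocess F').length ≤ (N + 2) ^ 4 := by
    have h₁ : (D.space F' : ℝ) ≤ N ^ 4 := by
      calc (D.space F' : ℝ) ≤ 9 * C * X := hspace
        _ ≤ N ^ 2 * N ^ 2 := by gcongr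
        _ = N ^ 4 := by ring
    have h₂ : D.space F' ≤ N ^ 4 := by exact_mod_cast h₁
    exact h₂.trans (Nat.pow_le_pow_left (by omega) 4)
  have hidxm : ∀ i, ∃ k ≤ N, τ < (F.set i).card → ∃ i' : Fin F'.m, i' = k ∧ idx i i' := by
    intro i
    by_cases hi : τ < (F.set i).card
    · obtain ⟨i', hi'⟩ := hidx i hi
      have := F'.m_le_size
      exact ⟨i', by omega, fun _ => ⟨i', rfl, hi'⟩⟩
    · exact ⟨0, by omega, fun h => absurd h hi⟩
  choose ix hixN hix using hidxm
  obtain ⟨data, h, h₁, h₂, h₃, h₄⟩ := exists_encoding D.wordExp D.query F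
    (fun i => (F.set i).card ≤ τ) E ix (fun i => by rw [hF]; exact hixN i) (D.preprocess F')
    (by rw [hF, ← hsize]; exact hwords) (by rw [hF]; exact hlen) τ ⌊C * t⌋₊ (by omega)
    (fun _ h => h) (by
      intro i j hi hj
      obtain ⟨i', hi', hii⟩ := hix i (not_le.1 hi)
      obtain ⟨j', hj', hjj⟩ := hix j (not_le.1 hj)
      obtain ⟨t', s', he, hs'⟩ := hquery i' j'
      refine ⟨t', s', Nat.le_floor (htime i' j' t' _ ⟨s', he, rfl⟩), ?_, ?_, ?_⟩
      · rw [hF, ← hsize, ← hi', ← hj']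
        exact he
      · rw [hs']
        split_ifs <;> simp
      · rw [hs', ← hcorrect i j i' j' (not_le.1 hi) (not_le.1 hj) hii hjj]
        simp)
  refine ⟨data, h₂, ?_, fun i j => ?_⟩
  · rw [hF] at h₃
    have h₃' : (data.length : ℝ) ≤ 9 * (D.space F' + 4 * (N + E.card + 1)) := by exact_mod_cast h₃
    -- Here `N`, `E.card` and `1` are at most `X`, `6 * X` and `X`, giving `9 * (9 * C + 4 * 8) = 81
    -- * C + 288`.
    linarith
  · obtain ⟨t', s', ht', he⟩ := h₄ i j
    refine ⟨t', s', ?_, he⟩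
    have ht'' : (t' : ℝ) ≤ (10 * h + 26) * τ + 2 * ⌊C * t⌋₊ + 38 := by exact_mod_cast ht'
    have hfl : (⌊C * t⌋₊ : ℝ) ≤ C * t := Nat.floor_le (by positivity)
    rw [hF] at h₁
    exact ht''.trans (query_time_le hN' hC ht (Nat.cast_nonneg _) hτ₂ hfl h₁)

end DataStructure

/-! ### The parameters of the reduction -/

/-- Each constraint on `a` buys one estimate: `4 * a ≤ δ` gives `t ≥ 1`, `2 * a ≤ δ * ε₂` makes the
assumed query time at most `t`, and `2 * a ≤ ε₁` turns the saving in the exponent of `m` into a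
factor `n ^ a`, since `n / t ≥ n ^ (1 / 2)`. -/
theorem reduction_parameters {n u δ ε₁ ε₂ a : ℝ} (hn : 1 ≤ n) (hu₁ : n ^ δ ≤ u) (hu₂ : u ≤ n)
    (ha : 0 < a) (haδ : 4 * a ≤ δ) (haε : 2 * a ≤ δ * ε₂) (hε₂ : 0 < ε₂)
    (ha₁ : 2 * a ≤ ε₁) (ha₂ : 2 * a ≤ 1) :
    1 ≤ n ^ a ∧ 1 ≤ u ^ (1 / 2 : ℝ) / (n ^ a) ^ 2 ∧
      (u ^ (1 / 2 : ℝ) / (n ^ a) ^ 2) ^ 2 * (n ^ a) ^ 4 = u ∧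
      u ^ (1 / 2 - ε₂) ≤ u ^ (1 / 2 : ℝ) / (n ^ a) ^ 2 ∧
      ∀ m, 1 ≤ m → m ≤ 3 * (n / (u ^ (1 / 2 : ℝ) / (n ^ a) ^ 2)) →
        m ^ (2 - ε₁) ≤ 9 * ((n / (u ^ (1 / 2 : ℝ) / (n ^ a) ^ 2)) ^ 2 / n ^ a) := by
  have hn0 : 0 < n := by linarith
  have hp : 1 ≤ n ^ a := Real.one_le_rpow hn ha.le
  have hp0 : 0 < n ^ a := by linarith
  have hu0 : 0 < u := (Real.rpow_pos_of_pos hn0 δ).trans_le hu₁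
  have hp2 : (n ^ a) ^ 2 = n ^ (2 * a) := by
    rw [← Real.rpow_natCast, ← Real.rpow_mul hn0.le, mul_comm]
    norm_num
  have hsq : (u ^ (1 / 2 : ℝ)) ^ 2 = u := by
    rw [← Real.rpow_natCast, ← Real.rpow_mul hu0.le]
    norm_num
  have hu0' : 0 < u ^ (1 / 2 : ℝ) := Real.rpow_pos_of_pos hu0 _
  set t := u ^ (1 / 2 : ℝ) / (n ^ a) ^ 2 with ht
  have ht1 : 1 ≤ t := by
    rw [ht, one_le_div (by positivity), hp2]
    calc n ^ (2 * a) ≤ n ^ (δ * (1 / 2)) := Real.rpow_le_rpow_of_exponent_le hn (by linarith)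
      _ = (n ^ δ) ^ (1 / 2 : ℝ) := Real.rpow_mul hn0.le _ _
      _ ≤ u ^ (1 / 2 : ℝ) := Real.rpow_le_rpow (by positivity) hu₁ (by norm_num)
  have htu : t ≤ n ^ (1 / 2 : ℝ) :=
    (div_le_self hu0'.le (one_le_pow₀ hp)).trans (Real.rpow_le_rpow hu0.le hu₂ (by norm_num))
  refine ⟨hp, ht1, ?_, ?_, ?_⟩
  · rw [ht, div_pow, hsq]
    field_simp
  · rw [ht, Real.rpow_sub hu0]
    refine div_le_div_of_nonneg_left hu0'.le (by positivity) ?_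
    rw [hp2]
    calc n ^ (2 * a) ≤ n ^ (δ * ε₂) := Real.rpow_le_rpow_of_exponent_le hn haε
      _ = (n ^ δ) ^ ε₂ := Real.rpow_mul hn0.le _ _
      _ ≤ u ^ ε₂ := Real.rpow_le_rpow (by positivity) hu₁ hε₂.le
  · intro m hm hm3
    have hr : n ^ (1 / 2 : ℝ) ≤ n / t := by
      rw [le_div_iff₀ (by linarith)]
      calc n ^ (1 / 2 : ℝ) * t ≤ n ^ (1 / 2 : ℝ) * n ^ (1 / 2 : ℝ) := by gcongr
        _ = n := by rw [← Real.rpow_add hn0]; norm_num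
    have hr0 : 0 < n / t := div_pos hn0 (by linarith)
    have hpr : n ^ a ≤ (3 * (n / t)) ^ (2 * a) := by
      calc n ^ a = (n ^ (1 / 2 : ℝ)) ^ (2 * a) := by
            rw [← Real.rpow_mul hn0.le]
            congr 1
            ring
        _ ≤ (3 * (n / t)) ^ (2 * a) := by
            refine Real.rpow_le_rpow (by positivity) ?_ (by positivity)
            linarith
    calc m ^ (2 - ε₁) ≤ m ^ (2 - 2 * a) := Real.rpow_le_rpow_of_exponent_le hm (by linarith)
      _ ≤ (3 * (n / t)) ^ (2 - 2 * a) := Real.rpow_le_rpow (by linarith) hm3 (by linarith)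
      _ = (3 * (n / t)) ^ 2 / (3 * (n / t)) ^ (2 * a) := by
          rw [Real.rpow_sub (by positivity), Real.rpow_two]
      _ ≤ (3 * (n / t)) ^ 2 / n ^ a := by gcongr
      _ = 9 * ((n / t) ^ 2 / n ^ a) := by ring

theorem eventually_mul_log_pow_lt {A c a : ℝ} (hA : 0 < A) (hc : 0 < c) (ha : 0 < a) (k : ℕ) :
    ∀ᶠ N : ℕ in atTop, A * Real.log N ^ k < c * (N : ℝ) ^ a := by
  have h := (isLittleO_log_rpow_rpow_atTop (k : ℝ) ha).comp_tendsto
    (tendsto_natCast_atTop_atTop (R := ℝ))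
  filter_upwards [h.bound (show 0 < c / (2 * A) by positivity), eventually_ge_atTop 1] with N hN hN1
  have hN1' : (1 : ℝ) ≤ N := by exact_mod_cast hN1
  have hpos : 0 < (N : ℝ) ^ a := Real.rpow_pos_of_pos (by linarith) a
  simp only [Function.comp, Real.rpow_natCast, Real.norm_eq_abs, abs_of_pos hpos] at hN
  calc A * Real.log N ^ k ≤ A * (c / (2 * A) * (N : ℝ) ^ a) :=
        mul_le_mul_of_nonneg_left ((le_abs_self _).trans hN) hA.le
    _ = c * (N : ℝ) ^ a / 2 := by field_simp
    _ < c * (N : ℝ) ^ a := by linarith [mul_pos hc hpos]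

/-! ### The contradiction with the conjecture. -/

theorem SetFamily.one_le_m_of_size_pos (F : SetFamily) (h : 0 < F.size) : 1 ≤ F.m := by
  by_contra hm
  have hm : F.m = 0 := by omega
  have : IsEmpty (Fin F.m) := by rw [hm]; infer_instance
  simp [SetFamily.size] at h

theorem mainTheorem1
    (hSSDC : StrongSetDisjointnessConjecture)
    (δ : ℝ) (hδ : 0 < δ)
    (u : ℕ → ℕ) (hu : ∀ᶠ N : ℕ in atTop, (N : ℝ) ^ δ ≤ (u N : ℝ) ∧ u N ≤ N)
    (D : DataStructure) (hD : D.Solves {F | F.InUniverse (u F.size)})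
    (ε₁ ε₂ C : ℝ) (hε₁ : 0 < ε₁) (hε₂ : 0 < ε₂) :
    ∀ᶠ N : ℕ in atTop, ∃ F : SetFamily, F.size = N ∧ F.InUniverse (u N) ∧
      (C * (F.m : ℝ) ^ (2 - ε₁) < (D.space F : ℝ) ∨
        ¬ D.QueryTimeLE F (C * (u N : ℝ) ^ (1 / 2 - ε₂))) := by
  classical
  by_contra hneg
  rw [not_eventually] at hneg
  obtain ⟨a, ha, haδ, haε, ha₁, ha₂⟩ : ∃ a : ℝ, 0 < a ∧ 4 * a ≤ δ ∧ 2 * a ≤ δ * ε₂ ∧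
      2 * a ≤ ε₁ ∧ 2 * a ≤ 1 := by
    have hδε : 0 < δ * ε₂ := mul_pos hδ hε₂
    refine ⟨min (min (δ / 4) (δ * ε₂ / 2)) (min (ε₁ / 2) (1 / 2)), by positivity, ?_, ?_, ?_, ?_⟩
    · linarith [(min_le_left _ (min (ε₁ / 2) (1 / 2))).trans (min_le_left (δ / 4) (δ * ε₂ / 2))]
    · linarith [(min_le_left _ (min (ε₁ / 2) (1 / 2))).trans (min_le_right (δ / 4) (δ * ε₂ / 2))]
    · linarith [(min_le_right (min (δ / 4) (δ * ε₂ / 2)) _).trans (min_le_left (ε₁ / 2) (1 / 2))]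
    · linarith [(min_le_right (min (δ / 4) (δ * ε₂ / 2)) _).trans (min_le_right (ε₁ / 2) (1 / 2))]
  set t : ℕ → ℝ := fun N => (u N : ℝ) ^ (1 / 2 : ℝ) / ((N : ℝ) ^ a) ^ 2 with ht
  -- The sizes at which the improved encoding exists. They are only known to be unbounded, which
  -- suffices against a lower bound holding eventually.
  let Good : ℕ → Prop := fun N => 2 ≤ N ∧ 1 ≤ t N ∧
    ∀ F : SetFamily, F.size = N → ∃ data, D.Encodes F data
      ((81 * |C| + 288) * ((N / t N) ^ 2 / (N : ℝ) ^ a)) ((380 + 4 * |C|) * (t N * Real.log N))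
  have hgood : ∃ᶠ N : ℕ in atTop, Good N := by
    have hlarge : ∀ᶠ N : ℕ in atTop, 9 * |C| ≤ (N : ℝ) ^ 2 :=
      ((tendsto_pow_atTop two_ne_zero).comp tendsto_natCast_atTop_atTop).eventually_ge_atTop _
    refine (hneg.and_eventually (hu.and (hlarge.and (eventually_ge_atTop 2)))).mono ?_
    rintro N ⟨hbad, ⟨hu₁, hu₂⟩, hCN, hN⟩
    have hN1 : (1 : ℝ) ≤ N := by exact_mod_cast (by omega : 1 ≤ N)
    obtain ⟨hp, ht1, htp, htime, hspace⟩ := reduction_parameters hN1 hu₁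
      (by exact_mod_cast hu₂) ha haδ haε hε₂ ha₁ ha₂
    refine ⟨hN, ht1, D.exists_encodes_of_bounds hD hN (abs_nonneg C) ht1 hp htp hu₂ hCN ?_⟩
    intro F hF hFu hm
    push Not at hbad
    obtain ⟨hS, hT⟩ := hbad F hF hFu
    have hm1 : (1 : ℝ) ≤ F.m := by exact_mod_cast F.one_le_m_of_size_pos (by omega)
    constructor
    · calc (D.space F : ℝ) ≤ C * (F.m : ℝ) ^ (2 - ε₁) := hS
        _ ≤ |C| * (F.m : ℝ) ^ (2 - ε₁) := by gcongr; exact le_abs_self C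
        _ ≤ |C| * (9 * ((N / t N) ^ 2 / (N : ℝ) ^ a)) := by gcongr; exact hspace _ hm1 hm
        _ = _ := by ring
    · intro i j s b hs
      calc (s : ℝ) ≤ C * (u N : ℝ) ^ (1 / 2 - ε₂) := hT i j s b hs
        _ ≤ |C| * (u N : ℝ) ^ (1 / 2 - ε₂) := by gcongr; exact le_abs_self C
        _ ≤ |C| * t N := by gcongr
  obtain ⟨S₀, T₀, h₀⟩ := D.exists_encodes
  obtain ⟨c, k, hc, hlower⟩ := D.lower_bound hSSDC
    (S := fun N => if Good N then (81 * |C| + 288) * ((N / t N) ^ 2 / (N : ℝ) ^ a) else S₀ N)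
    (T := fun N => if Good N then (380 + 4 * |C|) * (t N * Real.log N) else T₀ N) (by
      intro F
      by_cases h : Good F.size
      · simp only [if_pos h]
        exact h.2.2 F rfl
      · simp only [if_neg h]
        exact h₀ F)
  have hlog := eventually_mul_log_pow_lt (A := (81 * |C| + 288) * (380 + 4 * |C|) ^ 2)
    (by positivity) hc ha (k + 2)
  obtain ⟨N, hN, hlow, hlt⟩ := (hgood.and_eventually (hlower.and hlog)).exists
  simp only [if_pos hN] at hlow
  obtain ⟨hN2, ht1, -⟩ := hN
  have hN2' : (2 : ℝ) ≤ N := by exact_mod_cast hN2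
  have hN0 : (0 : ℝ) < N := by linarith
  have ht0 : 0 < t N := by linarith
  have hl0 : 0 < Real.log N := Real.log_pos (by linarith)
  have hp0 : 0 < (N : ℝ) ^ a := Real.rpow_pos_of_pos hN0 a
  have hC2 : 0 < 380 + 4 * |C| := by positivity
  refine hlt.not_ge ?_
  -- A common positive factor is split off both sides; cancelling it leaves `c * N ^ a` at most a
  -- constant times `Real.log N ^ (k + 2)`, where two of the logarithms come from the squared query
  -- time.
  have key : c * ((N : ℝ) ^ 2 / ((380 + 4 * |C|) * (t N * Real.log N)) ^ 2) / Real.log N ^ k =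
      c * (N : ℝ) ^ a * (N ^ 2 / (t N ^ 2 * (N : ℝ) ^ a * (380 + 4 * |C|) ^ 2 *
        Real.log N ^ (k + 2))) := by
    field_simp
    ring
  have key' : (81 * |C| + 288) * ((N / t N) ^ 2 / (N : ℝ) ^ a) =
      (81 * |C| + 288) * (380 + 4 * |C|) ^ 2 * Real.log N ^ (k + 2) *
      (N ^ 2 / (t N ^ 2 * (N : ℝ) ^ a * (380 + 4 * |C|) ^ 2 * Real.log N ^ (k + 2))) := by
    field_simp
  rw [key, key'] at hlow
  exact le_of_mul_le_mul_right hlow (by positivity)
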